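/- Let $\ell \ge 2$ be a fixed integer. An $\ell$-star is a tree with $\ell$ leaves and one non-leaf vertex (its center). Let $G=(V,E)$ be an undirected simple graph with $V=\{0,\dots,n-1\}$ and $m=|E|$, in which every vertex $v$ carries a real attribute $A_v$. For an interval $q=[x_1,x_2]$, let $G_q$ be the subgraph of $G$ induced by $\{v\in V : x_1\le A_v\le x_2\}$. An occurrence of the $\ell$-star in $G_q$ is a subgraph of $G_q$ that is isomorphic to the $\ell$-star. The model is a RAM whose words have $\Theta(\log n)$ bits (the constant may depend on $\ell$) and in which real numbers, held in cells of their own, can be copied and compared; time is the number of atomic operations, and the space of a data structure is its number of cells. The data structure depends on $G$ and $A$ but not on the queries; queries only read it and have a separate working memory. Then, for every such $G$ and $A$, there is a data structure of $O(m)$ space on which a listing query can be answered with delay $\tilde O(1)$: there is a query algorithm, depending only on $\ell$, that, given any $x_1,x_2\in\mathbb R$, outputs every occurrence of the $\ell$-star in $G_q$ exactly once, each as the tuple of its center and its $\ell$ leaves, and then stops, such that the time from the start to the first output, between any two consecutive outputs, and from the last output to the stop (from the start to the stop if there is no occurrence) is $\tilde O(1)$. With the same data structure, one can decide, for any $x_1,x_2\in\mathbb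 R$, in total time $\tilde O(1)$ whether $G_q$ contains an occurrence of the $\ell$-star. Here $\tilde O(1)$ means at most $C\log^{k}(m+2)$, and the constants hidden in $O(m)$ and in $C,k$ depend only on $\ell$. -/

import Mathlib

namespace RangeListing

/-! ### A word RAM with comparison-only access to real numbers

A query algorithm has read-only access to a stored data structure, which consists of word cells and
real cells, and has word registers, real registers and a read-write working memory of words.
Words are natural numbers below `2 ^ w`, where `w` is the word length; the results of arithmetic
are reduced modulo `2 ^ w`. Real numbers can only be copied and compared. -/

/-- The instructions. Every instruction is one atomic operation and costs one unit of time. -/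
inductive Instr where
  /-- `reg r := c` -/
  | const (r c : ℕ)
  /-- `reg r := reg a` -/
  | copy (r a : ℕ)
  /-- `reg r := reg a + reg b` -/
  | add (r a b : ℕ)
  /-- `reg r := reg a - reg b` (zero if `reg a < reg b`) -/
  | sub (r a b : ℕ)
  /-- `reg r := reg a * reg b` -/
  | mul (r a b : ℕ)
  /-- `reg r := reg a / reg b` (integer division) -/
  | div (r a b : ℕ)
  /-- `reg r := mem (reg a)` -/
  | load (r a : ℕ)
  /-- `mem (reg a) := reg b` -/
  | store (a b : ℕ)
  /-- `reg r :=` the word cell number `reg a` of the data structure -/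
  | fetch (r a : ℕ)
  /-- `real r :=` the real cell number `reg a` of the data structure -/
  | fetchReal (r a : ℕ)
  /-- `real r := real a` -/
  | copyReal (r a : ℕ)
  /-- continue at instruction `target` -/
  | jump (target : ℕ)
  /-- continue at instruction `target` if `reg a ≤ reg b` -/
  | jumpLe (a b target : ℕ)
  /-- continue at instruction `target` if `real a ≤ real b` -/
  | jumpRealLe (a b target : ℕ)
  /-- output the tuple of the words in the listed registers (a fixed list in the program) -/
  | report (regs : List ℕ)
  /-- stop -/
  | halt

/-- A program is a finite list of instructions. -/
abbrev Program := List Instr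

/-- A stored data structure: finitely many word cells and finitely many real cells. -/
structure Store where
  words : List ℕ
  reals : List ℝ

/-- The space of a data structure is its number of cells. -/
def Store.space (S : Store) : ℕ := S.words.length + S.reals.length

/-- All word cells of the data structure hold words of length `w`. -/
def Store.Fits (S : Store) (w : ℕ) : Prop := ∀ x ∈ S.words, x < 2 ^ w

/-- The state of the machine during a query. -/
structure State where
  pc : ℕ
  reg : ℕ → ℕ
  real : ℕ → ℝ
  mem : ℕ → ℕ

/-- The initial state for the query interval `[x₁, x₂]`: the endpoints are in the real
registers `0` and `1`; everything else is zero. -/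
def State.init (x₁ x₂ : ℝ) : State where
  pc := 0
  reg := fun _ => 0
  real := fun i => if i = 0 then x₁ else if i = 1 then x₂ else 0
  mem := fun _ => 0

/-- Go to the next instruction. -/
def State.next (s : State) : State := { s with pc := s.pc + 1 }

/-- Write `x`, reduced to a word of length `w`, into register `r`; go to the next instruction. -/
def State.setReg (w : ℕ) (s : State) (r x : ℕ) : State :=
  { s.next with reg := Function.update s.reg r (x % 2 ^ w) }

/-- Write `x` into the real register `r` and go to the next instruction. -/
def State.setReal (s : State) (r : ℕ) (x : ℝ) : State :=
  { s.next with real := Function.update s.real r x }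

open Classical in
/-- Execute one instruction with word length `w` on the data structure `S`. The result is `none`
if the instruction stops the machine, and otherwise consists of the new state and the tuple that
has been output, if any. Cells beyond the end of the data structure read as zero. -/
noncomputable def exec (S : Store) (w : ℕ) (s : State) : Instr → Option (State × Option (List ℕ))
  | .const r c => some (s.setReg w r c, none)
  | .copy r a => some (s.setReg w r (s.reg a), none)
  | .add r a b => some (s.setReg w r (s.reg a + s.reg b), none)
  | .sub r a b => some (s.setReg w r (s.reg a - s.reg b), none)
  | .mul r a b => some (s.setReg w r (s.reg a * s.reg b), none)
  | .div r a b => some (s.setReg w r (s.reg a / s.reg b), none)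
  | .load r a => some (s.setReg w r (s.mem (s.reg a)), none)
  | .store a b => some ({ s.next with mem := Function.update s.mem (s.reg a) (s.reg b) }, none)
  | .fetch r a => some (s.setReg w r (S.words.getD (s.reg a) 0), none)
  | .fetchReal r a => some (s.setReal r (S.reals.getD (s.reg a) 0), none)
  | .copyReal r a => some (s.setReal r (s.real a), none)
  | .jump t => some ({ s with pc := t }, none)
  | .jumpLe a b t => some (if s.reg a ≤ s.reg b then { s with pc := t } else s.next, none)
  | .jumpRealLe a b t => some (if s.real a ≤ s.real b then { s with pc := t } else s.next, none)
  | .report regs => some (s.next, some (regs.map s.reg))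
  | .halt => none

/-- One step of the program `P`. The machine also stops when there is no instruction at `pc`. -/
noncomputable def step (P : Program) (S : Store) (w : ℕ) (s : State) :
    Option (State × Option (List ℕ)) :=
  P[s.pc]?.bind (exec S w s)

/-- The first thing to be observed from outside: the machine has stopped, or it has output a
tuple and can be resumed from the state given. -/
inductive Event where
  | halted (s : State)
  | reported (o : List ℕ) (s : State)

/-- The first event within `t` units of time after the state `s`; `none` if there is none. -/
noncomputable def firstEvent (P : Program) (S : Store) (w : ℕ) : ℕ → State → Option Event
  | 0, _ => none
  | t + 1, s =>
    match step P S w s with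
    | none => some (.halted s)
    | some (s', none) => firstEvent P S w t s'
    | some (s', some o) => some (.reported o s')

/-- Started in the state `s`, the machine outputs exactly the tuples `outs`, in this order, and
stops. The time until the first output, between any two consecutive outputs, and between the last
output and the stop (or between start and stop if there is no output) is at most `Δ`. -/
def ListsWithDelay (P : Program) (S : Store) (w Δ : ℕ) : State → List (List ℕ) → Prop
  | s, [] => ∃ s', firstEvent P S w Δ s = some (.halted s')
  | s, o :: outs =>
    ∃ s', firstEvent P S w Δ s = some (.reported o s') ∧ ListsWithDelay P S w Δ s' outs

/-- Started in the state `s`, the machine stops within `T` units of time without any output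
instruction, and the content of the register `0` is then `answer`. -/
def AnswersWithin (P : Program) (S : Store) (w T : ℕ) (s : State) (answer : ℕ) : Prop :=
  ∃ s', firstEvent P S w T s = some (.halted s') ∧ s'.reg 0 = answer

/-! ### Range subgraph listing -/

/-- `G_q` for `q = [x₁, x₂]`: the subgraph of `G` induced by the vertices with attribute in `q`. -/
def rangeSubgraph {V : Type*} (G : SimpleGraph V) (A : V → ℝ) (x₁ x₂ : ℝ) : G.Subgraph :=
  (⊤ : G.Subgraph).induce {v | x₁ ≤ A v ∧ A v ≤ x₂}

/-- The occurrences of the pattern `Q` in `G_q`: the subgraphs of `G_q` isomorphic to `Q`. -/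
def occurrences {U V : Type*} (Q : SimpleGraph U) (G : SimpleGraph V) (A : V → ℝ) (x₁ x₂ : ℝ) :
    Set G.Subgraph :=
  {H | H ≤ rangeSubgraph G A x₁ x₂ ∧ Nonempty (Q ≃g H.coe)}

/-- A tuple of words describes the subgraph `H`, an image of the pattern `Q`, if its `i`-th entry
is the vertex of `H` that plays the role of the `i`-th vertex of `Q`. -/
def Describes {k n : ℕ} (Q : SimpleGraph (Fin k)) {G : SimpleGraph (Fin n)}
    (o : List ℕ) (H : G.Subgraph) : Prop :=
  ∃ f : SimpleGraph.Copy Q G, o = List.ofFn (fun i => (f i : ℕ)) ∧ f.toSubgraph = H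

/-- The tuples `outs` describe all the subgraphs in `X`, each of them exactly once. -/
def DescribesAllOnce {k n : ℕ} (Q : SimpleGraph (Fin k)) {G : SimpleGraph (Fin n)}
    (outs : List (List ℕ)) (X : Set G.Subgraph) : Prop :=
  ∃ Hs : List G.Subgraph, Hs.Nodup ∧ (∀ H, H ∈ Hs ↔ H ∈ X) ∧ List.Forall₂ (Describes Q) outs Hs

/-- The `ℓ`-star: a tree whose only non-leaf vertex `0` is adjacent to the `ℓ` leaves `1, …, ℓ`. -/
def starPattern (ℓ : ℕ) : SimpleGraph (Fin (ℓ + 1)) := SimpleGraph.starGraph 0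

/-- The word length `κ · ⌈log₂ (n + 2)⌉`. -/
def wordLength (κ n : ℕ) : ℕ := κ * Nat.clog 2 (n + 2)

/-- The bound `C · ⌊log₂ (m + 2)⌋ ^ k`. -/
def polylog (C k m : ℕ) : ℕ := C * Nat.log 2 (m + 2) ^ k

end RangeListing

/-! Replace every edge by its two darts and sort the `2m` darts by first vertex (the center), and
for equal centers by the attribute of the second vertex (the leaf). For a fixed center the leaves
with attribute in `[x₁, x₂]` occupy consecutive positions, so a star is a center in range together
with `ℓ` positions of that block. Classify stars by their smallest position `j`. The other positions
all lie in an interval `(j, R)`, where `R` is the first position at which the center changes or the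
leaf attribute exceeds `x₂` (`IsDartList.exists_bound`). Conversely, any `ℓ - 1` positions there
complete a star as soon as the center and leaf `j` are in range. Hence `j` occurs exactly when the
window of `ℓ` consecutive darts from `j` on is itself a star of `G_q`. This amounts to two
comparisons, `x₁ ≤ windowMin` and `windowMax ≤ x₂` (`IsDartList.mem_starPositions`).

The windows, at most `2m` of them, are sorted by `windowMin` in descending order and become the
leaves of a balanced binary tree whose nodes store the minimum of `windowMax` below them. A
traversal skips each subtree whose minimum exceeds `x₂`. A subtree that is entered contains a window
with `windowMax ≤ x₂`, and that window either produces an output or has `windowMin < x₁`, in which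
case all later windows fail too and the query stops. So only logarithmically many nodes lie between
events (`resumes_tree`). Preorder storage with subtree sizes makes a stack unnecessary.

Inside a window, `ℓ - 1` nested loops run through the combinations. Each loop checks that there is
room for all the leaves still to be chosen, so a descent always ends in an output (`resumes_level`).

Two different position lists never give the same subgraph: for `ℓ ≥ 2` a star determines its center
and its set of leaves, hence its darts (`IsDartList.eq_of_copy`). Detection is the listing program
with each report replaced by a jump to code that answers `1` (`Resumes.answersWithin`). -/

namespace RangeListing

/-! ### Reasoning backwards along runs of the machine -/

/-- Word field `x` of the record `p`. -/
def Store.word (S : Store) (p x : ℕ) : ℕ := S.words.getD (4 * p + x) 0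

/-- Real field `x` of the record `p`. -/
noncomputable def Store.realAt (S : Store) (p x : ℕ) : ℝ := S.reals.getD (4 * p + x) 0

section Machine

variable {P : Program} {S : Store} {w Δ : ℕ}

/-- From the state `s`, the first event happens within `T` units of time, the later ones with delay
`Δ`, and exactly the tuples `outs` are output. If there are none, register `0` finally holds zero. -/
def Resumes (P : Program) (S : Store) (w Δ T : ℕ) (s : State) : List (List ℕ) → Prop
  | [] => ∃ s', firstEvent P S w T s = some (.halted s') ∧ s'.reg 0 = 0
  | o :: outs =>
    ∃ s', firstEvent P S w T s = some (.reported o s') ∧ ListsWithDelay P S w Δ s' outs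

theorem firstEvent_succ {t : ℕ} {s : State} {e : Event} (h : firstEvent P S w t s = some e) :
    firstEvent P S w (t + 1) s = some e := by
  induction t generalizing s with
  | zero => simp [firstEvent] at h
  | succ t ih =>
    rw [firstEvent] at h ⊢
    rcases hs : step P S w s with _ | ⟨s', _ | o⟩
    · simpa [hs] using h
    · rw [hs] at h
      exact ih h
    · simpa [hs] using h

theorem firstEvent_mono {t t' : ℕ} (htt : t ≤ t') {s : State} {e : Event}
    (h : firstEvent P S w t s = some e) : firstEvent P S w t' s = some e := by
  induction htt with
  | refl => exact h
  | step _ ih => exact firstEvent_succ ih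

namespace Resumes

variable {T T' : ℕ} {s s' : State} {outs : List (List ℕ)}

theorem mono (h : Resumes P S w Δ T s outs) (hT : T ≤ T') : Resumes P S w Δ T' s outs := by
  cases outs with
  | nil =>
    obtain ⟨s', h1, h2⟩ := h
    exact ⟨s', firstEvent_mono hT h1, h2⟩
  | cons o outs =>
    obtain ⟨s', h1, h2⟩ := h
    exact ⟨s', firstEvent_mono hT h1, h2⟩

theorem lists (h : Resumes P S w Δ T s outs) (hT : T ≤ Δ) : ListsWithDelay P S w Δ s outs := by
  cases outs with
  | nil =>
    obtain ⟨s', h1, -⟩ := h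
    exact ⟨s', firstEvent_mono hT h1⟩
  | cons o outs =>
    obtain ⟨s', h1, h2⟩ := h
    exact ⟨s', firstEvent_mono hT h1, h2⟩

/-- A silent step only shifts the first event by one unit. This allows runs to be verified backwards
from a continuation, one instruction at a time, and the lemmas below specialize it to the
instructions. -/
theorem silent (hs : step P S w s = some (s', none)) (h : Resumes P S w Δ T s' outs) :
    Resumes P S w Δ (T + 1) s outs := by
  cases outs <;> simpa only [Resumes, firstEvent, hs] using h

variable {pc r a b c t x : ℕ} {reg : ℕ → ℕ} {real : ℕ → ℝ} {mem : ℕ → ℕ}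

theorem instr {i : Instr} (hi : P[s.pc]? = some i) (he : exec S w s i = some (s', none))
    (h : Resumes P S w Δ T s' outs) : Resumes P S w Δ (T + 1) s outs :=
  silent (by simp [step, hi, he]) h

theorem const (hi : P[pc]? = some (.const r c)) (hx : c < 2 ^ w)
    (h : Resumes P S w Δ T ⟨pc + 1, Function.update reg r c, real, mem⟩ outs) :
    Resumes P S w Δ (T + 1) ⟨pc, reg, real, mem⟩ outs :=
  instr hi (by simp [exec, State.setReg, State.next, Nat.mod_eq_of_lt hx]) h

theorem add (hi : P[pc]? = some (.add r a b)) (x : ℕ) (hx : reg a + reg b = x) (hw : x < 2 ^ w)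
    (h : Resumes P S w Δ T ⟨pc + 1, Function.update reg r x, real, mem⟩ outs) :
    Resumes P S w Δ (T + 1) ⟨pc, reg, real, mem⟩ outs :=
  instr hi (by simp [exec, State.setReg, State.next, hx, Nat.mod_eq_of_lt hw]) h

theorem sub (hi : P[pc]? = some (.sub r a b)) (x : ℕ) (hx : reg a - reg b = x) (hw : x < 2 ^ w)
    (h : Resumes P S w Δ T ⟨pc + 1, Function.update reg r x, real, mem⟩ outs) :
    Resumes P S w Δ (T + 1) ⟨pc, reg, real, mem⟩ outs :=
  instr hi (by simp [exec, State.setReg, State.next, hx, Nat.mod_eq_of_lt hw]) h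

theorem mul (hi : P[pc]? = some (.mul r a b)) (x : ℕ) (hx : reg a * reg b = x) (hw : x < 2 ^ w)
    (h : Resumes P S w Δ T ⟨pc + 1, Function.update reg r x, real, mem⟩ outs) :
    Resumes P S w Δ (T + 1) ⟨pc, reg, real, mem⟩ outs :=
  instr hi (by simp [exec, State.setReg, State.next, hx, Nat.mod_eq_of_lt hw]) h

theorem _root_.RangeListing.Store.Fits.getD_lt (hS : S.Fits w) (x : ℕ) :
    S.words.getD x 0 < 2 ^ w := by
  by_cases h : x < S.words.length
  · rw [List.getD_eq_getElem _ _ h]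
    exact hS _ (List.getElem_mem h)
  · rw [List.getD_eq_default _ _ (by omega)]
    positivity

theorem fetch (hS : S.Fits w) (hi : P[pc]? = some (.fetch r a)) (p x : ℕ) (hx : reg a = 4 * p + x)
    (h : Resumes P S w Δ T ⟨pc + 1, Function.update reg r (S.word p x), real, mem⟩ outs) :
    Resumes P S w Δ (T + 1) ⟨pc, reg, real, mem⟩ outs :=
  instr hi (by simp only [exec, State.setReg, State.next, hx,
    Nat.mod_eq_of_lt (hS.getD_lt _), Store.word]) h

theorem fetchReal (hi : P[pc]? = some (.fetchReal r a)) (p x : ℕ) (hx : reg a = 4 * p + x)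
    (h : Resumes P S w Δ T ⟨pc + 1, reg, Function.update real r (S.realAt p x), mem⟩ outs) :
    Resumes P S w Δ (T + 1) ⟨pc, reg, real, mem⟩ outs :=
  instr hi (by simp only [exec, State.setReal, State.next, hx, Store.realAt]) h

theorem jump (hi : P[pc]? = some (.jump t)) (h : Resumes P S w Δ T ⟨t, reg, real, mem⟩ outs) :
    Resumes P S w Δ (T + 1) ⟨pc, reg, real, mem⟩ outs :=
  instr hi rfl h

theorem jumpLe_true (hi : P[pc]? = some (.jumpLe a b t)) (hc : reg a ≤ reg b)
    (h : Resumes P S w Δ T ⟨t, reg, real, mem⟩ outs) :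
    Resumes P S w Δ (T + 1) ⟨pc, reg, real, mem⟩ outs :=
  instr hi (by simp [exec, hc]) h

theorem jumpLe_false (hi : P[pc]? = some (.jumpLe a b t)) (hc : ¬ reg a ≤ reg b)
    (h : Resumes P S w Δ T ⟨pc + 1, reg, real, mem⟩ outs) :
    Resumes P S w Δ (T + 1) ⟨pc, reg, real, mem⟩ outs :=
  instr hi (by simp only [exec, hc, if_false, State.next]) h

theorem jumpRealLe_true (hi : P[pc]? = some (.jumpRealLe a b t)) (hc : real a ≤ real b)
    (h : Resumes P S w Δ T ⟨t, reg, real, mem⟩ outs) :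
    Resumes P S w Δ (T + 1) ⟨pc, reg, real, mem⟩ outs :=
  instr hi (by simp [exec, hc]) h

theorem jumpRealLe_false (hi : P[pc]? = some (.jumpRealLe a b t)) (hc : ¬ real a ≤ real b)
    (h : Resumes P S w Δ T ⟨pc + 1, reg, real, mem⟩ outs) :
    Resumes P S w Δ (T + 1) ⟨pc, reg, real, mem⟩ outs :=
  instr hi (by simp only [exec, hc, if_false, State.next]) h

theorem halt (hi : P[pc]? = some .halt) (h0 : reg 0 = 0) :
    Resumes P S w Δ (T + 1) ⟨pc, reg, real, mem⟩ [] :=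
  ⟨⟨pc, reg, real, mem⟩, by simp [firstEvent, step, hi, exec], h0⟩

theorem report {regs o : List ℕ} (hi : P[pc]? = some (.report regs)) (ho : regs.map reg = o)
    (h : Resumes P S w Δ Δ ⟨pc + 1, reg, real, mem⟩ outs) :
    Resumes P S w Δ (T + 1) ⟨pc, reg, real, mem⟩ (o :: outs) :=
  ⟨⟨pc + 1, reg, real, mem⟩, by simp [firstEvent, step, hi, exec, State.next, ho], h.lists le_rfl⟩

end Resumes

/-! ### From listing to detection -/

/-- Jump to `t` instead of reporting. -/
def Instr.reportToJump (t : ℕ) : Instr → Instr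
  | .report _ => .jump t
  | i => i

/-- Jump to `t` instead of reporting. -/
def Program.reportToJump (P : Program) (t : ℕ) : Program := P.map (Instr.reportToJump t)

/-- The option `r` treats stopping (`none`) and continuing without output (`some`) together, since
neither involves a `report`. -/
theorem step_reportToJump_of_silent {t : ℕ} {s : State} {r : Option State}
    (h : step P S w s = r.map (·, none)) :
    step (P.reportToJump t) S w s = r.map (·, none) := by
  unfold step at h ⊢
  rw [Program.reportToJump, List.getElem?_map]
  rcases hi : P[s.pc]? with _ | i
  · simpa [hi] using h
  · rw [hi] at h
    cases i <;> simp_all [Instr.reportToJump, exec]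

theorem step_reportToJump_of_report {t : ℕ} {s s' : State} {o : List ℕ}
    (h : step P S w s = some (s', some o)) :
    step (P.reportToJump t) S w s = some ({ s with pc := t }, none) := by
  unfold step at h ⊢
  rw [Program.reportToJump, List.getElem?_map]
  rcases hi : P[s.pc]? with _ | i
  · simp [hi] at h
  · rw [hi] at h
    cases i <;> simp_all [Instr.reportToJump, exec]

theorem firstEvent_reportToJump_of_halted {t T : ℕ} {s s' : State}
    (h : firstEvent P S w T s = some (.halted s')) :
    firstEvent (P.reportToJump t) S w T s = some (.halted s') := by
  induction T generalizing s with
  | zero => simp [firstEvent] at h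
  | succ T ih =>
    rw [firstEvent] at h ⊢
    rcases hs : step P S w s with _ | ⟨s₁, _ | o⟩
    · rw [step_reportToJump_of_silent (r := none) hs]
      simpa [hs] using h
    · rw [step_reportToJump_of_silent (r := some s₁) hs]
      rw [hs] at h
      exact ih h
    · simp [hs] at h

/-- The jump costs as much as the report it replaces; the two extra units pay for setting register
`0` and for halting. The word length must be positive, as otherwise the answer `1` would be reduced
to `0`. -/
theorem firstEvent_reportToJump_of_reported {t T : ℕ} {s s' : State} {o : List ℕ}
    (h : firstEvent P S w T s = some (.reported o s')) (ht : P[t]? = some (.const 0 1))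
    (ht' : P[t + 1]? = some .halt) (hw : 0 < w) :
    ∃ s'', firstEvent (P.reportToJump t) S w (T + 2) s = some (.halted s'') ∧ s''.reg 0 = 1 := by
  induction T generalizing s with
  | zero => simp [firstEvent] at h
  | succ T ih =>
    rw [firstEvent] at h
    rw [show T + 1 + 2 = (T + 2) + 1 from rfl, firstEvent]
    rcases hs : step P S w s with _ | ⟨s₁, _ | o⟩
    · simp [hs] at h
    · rw [step_reportToJump_of_silent (r := some s₁) hs]
      rw [hs] at h
      exact ih h
    · rw [step_reportToJump_of_report hs]
      have h1 : 1 < 2 ^ w := Nat.one_lt_two_pow (by omega)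
      simp [firstEvent, step, Program.reportToJump, ht, ht', Instr.reportToJump, exec,
        State.setReg, State.next, Nat.mod_eq_of_lt h1]

theorem Resumes.answersWithin {t T T' : ℕ} {s : State} {outs : List (List ℕ)}
    (h : Resumes P S w Δ T s outs) (ht : P[t]? = some (.const 0 1))
    (ht' : P[t + 1]? = some .halt) (hw : 0 < w) (hT : T + 2 ≤ T') :
    AnswersWithin (P.reportToJump t) S w T' s (if outs = [] then 0 else 1) := by
  cases outs with
  | nil =>
    obtain ⟨s', h1, h2⟩ := h
    exact ⟨s', firstEvent_mono (by omega) (firstEvent_reportToJump_of_halted h1),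
      by simpa using h2⟩
  | cons o outs =>
    obtain ⟨s', h1, -⟩ := h
    obtain ⟨s'', h2, h3⟩ := firstEvent_reportToJump_of_reported h1 ht ht' hw
    exact ⟨s'', firstEvent_mono hT h2, by simpa using h3⟩

end Machine

/-! ### The query program -/

/-- The traversal of the tree of windows. Registers: `1` and `2` hold the constants `1` and `4`, `3`
the current node, `4` the size of its subtree, `5` and `6` are temporary, `7` and `8` hold the
center of the current window (with and without one added), `9` its first position in the list of
darts, and `10` the vertex at that position. -/
def traversalCode : List Instr := [
  .jump 3,
  -- Nothing in the listing program reaches this instruction; it is the target of the detection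
  -- program. The `halt` after it also serves as the exit at the end of the tree.
  .const 0 1,
  .halt,
  .const 1 1,
  .const 2 4,
  .mul 5 3 2,
  .add 5 5 1,
  .add 5 5 1,
  .fetch 4 5,
  -- Subtree sizes are positive, so a zero can only be read behind the last node.
  .jumpLe 4 0 2,
  .fetchReal 2 5,
  .jumpRealLe 2 1 14,
  -- In preorder, adding the size leads to the first node after the subtree.
  .add 3 3 4,
  .jump 5,
  .jumpLe 4 1 17,
  .add 3 3 1,
  .jump 5,
  .add 5 5 1,
  .fetchReal 2 5,
  .jumpRealLe 0 2 21,
  -- This window has `windowMin < x₁`, and so have all later ones by the order of the leaves.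
  .halt,
  .fetch 9 5,
  .mul 5 9 2,
  .fetch 10 5,
  .add 5 5 1,
  .fetch 7 5,
  .sub 8 7 1,
  .jump 30,
  .add 3 3 1,
  .jump 5]

/-- The loop over the positions of the leaf number `q + 2` of the star, which are kept in register
`11 + 2 * q`, while the vertex there is kept in register `12 + 2 * q`. -/
def levelCode (ℓ q : ℕ) : List Instr := [
  .add (11 + 2 * q) (9 + 2 * q) 1,
  -- The test looks ahead by the number of leaves still to be chosen after this one: if that dart is
  -- admissible, so are all between, and the loops inside cannot fail to complete the star.
  .const 5 (ℓ - 2 - q),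
  .add 5 5 (11 + 2 * q),
  .mul 5 5 2,
  .fetchReal 2 5,
  .add 5 5 1,
  .fetch 6 5,
  .jumpLe 7 6 (30 + 16 * q + 9),
  -- For `q > 0` this is the increment in the enclosing loop; for `q = 0` it is the step of the
  -- traversal to the next node.
  .jump (28 + 16 * q),
  .jumpRealLe 2 1 (30 + 16 * q + 11),
  .jump (28 + 16 * q),
  .mul 5 (11 + 2 * q) 2,
  .fetch (12 + 2 * q) 5,
  if q + 2 = ℓ then .report ((List.range (ℓ + 1)).map (fun i => 8 + 2 * i))
    else .jump (30 + 16 * (q + 1)),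
  .add (11 + 2 * q) (11 + 2 * q) 1,
  .jump (30 + 16 * q + 1)]

/-- The program that lists the `ℓ`-stars. -/
def listingProgram (ℓ : ℕ) : Program :=
  traversalCode ++ (List.range (ℓ - 1)).flatMap (levelCode ℓ)

theorem getElem?_flatMap_range {α : Type*} {f : ℕ → List α} {K : ℕ} (hf : ∀ q, (f q).length = K)
    {k q : ℕ} (hq : q < k) {i : ℕ} (hi : i < K) :
    ((List.range k).flatMap f)[K * q + i]? = (f q)[i]? := by
  have hlen : ∀ k, ((List.range k).flatMap f).length = K * k := by
    intro k
    induction k with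
    | zero => simp
    | succ k ih => simp [List.range_succ, ih, hf, Nat.mul_succ]
  induction k with
  | zero => omega
  | succ k ih =>
    rw [List.range_succ, List.flatMap_append]
    rcases Nat.lt_succ_iff_lt_or_eq.1 hq with h | rfl
    · rw [List.getElem?_append_left, ih h]
      rw [hlen]
      calc K * q + i < K * q + K := by omega
        _ = K * (q + 1) := by ring
        _ ≤ K * k := Nat.mul_le_mul_left _ h
    · rw [List.getElem?_append_right (by rw [hlen]; omega), hlen]
      simp

theorem listingProgram_level {ℓ q : ℕ} (hq : q + 2 ≤ ℓ) (i : ℕ) (hi : i < 16) :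
    (listingProgram ℓ)[30 + 16 * q + i]? = (levelCode ℓ q)[i]? := by
  rw [listingProgram, List.getElem?_append_right (by simp [traversalCode]; omega)]
  rw [show 30 + 16 * q + i - traversalCode.length = 16 * q + i by simp [traversalCode]; omega]
  exact getElem?_flatMap_range (fun _ => rfl) (by omega) (K := 16) hi

/-! ### Sublists of a given length -/

/-- The sublists of a given length, in lexicographic order. -/
def combinations {α : Type*} : ℕ → List α → List (List α)
  | 0, _ => [[]]
  | _ + 1, [] => []
  | r + 1, a :: l => (combinations r l).map (a :: ·) ++ combinations (r + 1) l

/-- The recursion of `combinations` mirrors the loops of the machine; membership and absence of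
duplicates do not depend on the order and are transferred from `List.sublistsLen`. -/
theorem combinations_perm {α : Type*} (r : ℕ) (l : List α) :
    (combinations r l).Perm (l.sublistsLen r) := by
  induction l generalizing r with
  | nil => cases r <;> simp [combinations]
  | cons a l ih =>
    cases r with
    | zero => simp [combinations]
    | succ r =>
      rw [combinations, List.sublistsLen_succ_cons]
      exact (((ih r).map _).append (ih (r + 1))).trans List.perm_append_comm

theorem mem_combinations {α : Type*} {r : ℕ} {l l' : List α} :
    l' ∈ combinations r l ↔ l'.Sublist l ∧ l'.length = r := by
  rw [(combinations_perm r l).mem_iff, List.mem_sublistsLen]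

theorem nodup_combinations {α : Type*} (r : ℕ) {l : List α} (h : l.Nodup) :
    (combinations r l).Nodup :=
  (combinations_perm r l).nodup_iff.2 (List.nodup_sublistsLen r h)

theorem combinations_eq_nil {α : Type*} {r : ℕ} {l : List α} (h : l.length < r) :
    combinations r l = [] := by
  rw [List.eq_nil_iff_forall_not_mem]
  intro l' hl'
  obtain ⟨h1, h2⟩ := mem_combinations.1 hl'
  have := h1.length_le
  omega

/-! ### The nested loops over the leaves -/

section Levels

variable {ℓ : ℕ} {S : Store} {w Δ N c R : ℕ} {x₁ x₂ : ℝ} {mem : ℕ → ℕ}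

theorem resumes_level_fail (hS : S.Fits w) (hN : 4 * (N + ℓ) + 8 ≤ 2 ^ w)
    (r q : ℕ) (hq : q + r + 2 = ℓ) {lo : ℕ} (hlo : lo ≤ N)
    (hp : ¬ (c ≤ S.word (lo + r) 1 ∧ S.realAt (lo + r) 0 ≤ x₂))
    {reg : ℕ → ℕ} {real : ℕ → ℝ} (h1 : reg 1 = 1) (h2 : reg 2 = 4) (h7 : reg 7 = c)
    (hJ : reg (11 + 2 * q) = lo) (hx1 : real 0 = x₁) (hx2 : real 1 = x₂)
    {rest : List (List ℕ)} {T : ℕ}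
    (hexit : ∀ (reg' : ℕ → ℕ) (real' : ℕ → ℝ),
      (∀ i < 11 + 2 * q, i ≠ 5 → i ≠ 6 → reg' i = reg i) → real' 0 = x₁ → real' 1 = x₂ →
      Resumes (listingProgram ℓ) S w Δ T ⟨28 + 16 * q, reg', real', mem⟩ rest) :
    Resumes (listingProgram ℓ) S w Δ (T + 9) ⟨30 + 16 * q + 1, reg, real, mem⟩ rest := by
  have hP := fun i hi => listingProgram_level (ℓ := ℓ) (q := q) (by omega) i hi
  have hJ5 : 11 + 2 * q ≠ 5 := by omega
  refine .const (hP 1 (by omega)) (by omega) ?_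
  refine .add (hP 2 (by omega)) (lo + r) (by simp [hJ5, hJ]; omega) (by omega) ?_
  refine .mul (hP 3 (by omega)) (4 * (lo + r)) (by simp [h2, Nat.mul_comm _ 4]) (by omega) ?_
  refine .fetchReal (hP 4 (by omega)) (lo + r) 0 (by simp) ?_
  refine .add (hP 5 (by omega)) (4 * (lo + r) + 1) (by simp [h1]) (by omega) ?_
  refine .fetch hS (hP 6 (by omega)) (lo + r) 1 (by simp) ?_
  rw [not_and_or] at hp
  by_cases hc : c ≤ S.word (lo + r) 1
  · refine .jumpLe_true (hP 7 (by omega)) (by simpa [h7] using hc) ?_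
    refine .jumpRealLe_false (hP 9 (by omega))
      (by simpa [hx2] using hp.resolve_left (not_not.2 hc)) ?_
    refine .jump (hP 10 (by omega)) ?_
    exact hexit _ _ (by intro i hi h5 h6; simp [h5, h6]) (by simpa using hx1) (by simpa using hx2)
  · refine .mono (T := T + 2) ?_ (Nat.le_succ _)
    refine .jumpLe_false (hP 7 (by omega)) (by simpa [h7] using hc) ?_
    refine .jump (hP 8 (by omega)) ?_
    exact hexit _ _ (by intro i hi h5 h6; simp [h5, h6]) (by simpa using hx1) (by simpa using hx2)

theorem resumes_level_pass (hS : S.Fits w) (hN : 4 * (N + ℓ) + 8 ≤ 2 ^ w)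
    (r q : ℕ) (hq : q + r + 2 = ℓ) {lo : ℕ} (hlo : lo ≤ N)
    (hp : c ≤ S.word (lo + r) 1 ∧ S.realAt (lo + r) 0 ≤ x₂)
    {reg : ℕ → ℕ} {real : ℕ → ℝ} (h1 : reg 1 = 1) (h2 : reg 2 = 4) (h7 : reg 7 = c)
    (hJ : reg (11 + 2 * q) = lo) (hx1 : real 0 = x₁) (hx2 : real 1 = x₂)
    {outs : List (List ℕ)} {T : ℕ}
    (hnext : ∀ (reg' : ℕ → ℕ) (real' : ℕ → ℝ),
      (∀ i < 12 + 2 * q, i ≠ 5 → i ≠ 6 → reg' i = reg i) → reg' (12 + 2 * q) = S.word lo 0 →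
      real' 0 = x₁ → real' 1 = x₂ →
      Resumes (listingProgram ℓ) S w Δ T ⟨30 + 16 * q + 13, reg', real', mem⟩ outs) :
    Resumes (listingProgram ℓ) S w Δ (T + 10) ⟨30 + 16 * q + 1, reg, real, mem⟩ outs := by
  have hP := fun i hi => listingProgram_level (ℓ := ℓ) (q := q) (by omega) i hi
  have hJ5 : 11 + 2 * q ≠ 5 := by omega
  have hJ6 : 11 + 2 * q ≠ 6 := by omega
  refine .const (hP 1 (by omega)) (by omega) ?_
  refine .add (hP 2 (by omega)) (lo + r) (by simp [hJ5, hJ]; omega) (by omega) ?_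
  refine .mul (hP 3 (by omega)) (4 * (lo + r)) (by simp [h2, Nat.mul_comm _ 4]) (by omega) ?_
  refine .fetchReal (hP 4 (by omega)) (lo + r) 0 (by simp) ?_
  refine .add (hP 5 (by omega)) (4 * (lo + r) + 1) (by simp [h1]) (by omega) ?_
  refine .fetch hS (hP 6 (by omega)) (lo + r) 1 (by simp) ?_
  refine .jumpLe_true (hP 7 (by omega)) (by simpa [h7] using hp.1) ?_
  refine .jumpRealLe_true (hP 9 (by omega)) (by simpa [hx2] using hp.2) ?_
  refine .mul (hP 11 (by omega)) (4 * lo) (by simp [hJ5, hJ6, hJ, h2, Nat.mul_comm lo 4]) (by omega) ?_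
  refine .fetch hS (hP 12 (by omega)) lo 0 (by simp) ?_
  refine hnext _ _ ?_ (by simp) (by simpa using hx1) (by simpa using hx2)
  intro i hi h5 h6
  simp [h5, h6, hi.ne]

/-- Here `r` leaves remain to be chosen after the current one and `n` candidates are left. If `r + 1
≤ n`, each of the `r + 1` loops passes its test at once and an output follows in time independent of
the exit cost `T`. Otherwise nothing is output and the first test leads to the exit. -/
theorem resumes_level (hS : S.Fits w) (hN : 4 * (N + ℓ) + 8 ≤ 2 ^ w) (hRN : R ≤ N)
    (r q : ℕ) (hq : q + r + 2 = ℓ) (n lo : ℕ) (hn : lo + n = R)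
    (hR : ∀ p, lo ≤ p → (c ≤ S.word p 1 ∧ S.realAt p 0 ≤ x₂ ↔ p < R))
    (reg : ℕ → ℕ) (real : ℕ → ℝ) (h1 : reg 1 = 1) (h2 : reg 2 = 4) (h7 : reg 7 = c)
    (hJ : reg (11 + 2 * q) = lo) (hx1 : real 0 = x₁) (hx2 : real 1 = x₂)
    (pre : List ℕ) (hpre : (List.range (q + 2)).map (fun i => reg (8 + 2 * i)) = pre)
    (rest : List (List ℕ)) (T : ℕ)
    (hexit : ∀ (reg' : ℕ → ℕ) (real' : ℕ → ℝ),
      (∀ i < 11 + 2 * q, i ≠ 5 → i ≠ 6 → reg' i = reg i) → real' 0 = x₁ → real' 1 = x₂ →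
      Resumes (listingProgram ℓ) S w Δ T ⟨28 + 16 * q, reg', real', mem⟩ rest)
    (hT : T + 20 * (r + 2) ≤ Δ) (hΔ : 20 * (2 * r + 4) ≤ Δ) :
    Resumes (listingProgram ℓ) S w Δ (if r + 1 ≤ n then 20 * (r + 1) else T + 12)
      ⟨30 + 16 * q + 1, reg, real, mem⟩
      ((combinations (r + 1) (List.range' lo n)).map
        (fun js => pre ++ js.map (S.word · 0)) ++ rest) := by
  induction r using Nat.strong_induction_on generalizing q n lo reg real pre rest T with
  | _ r ih =>
  have hP := fun i hi => listingProgram_level (ℓ := ℓ) (q := q) (by omega) i hi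
  induction n generalizing lo reg real with
  | zero =>
    simp only [List.range'_zero, combinations, List.map_nil, List.nil_append]
    rw [if_neg (by omega)]
    exact .mono (resumes_level_fail hS hN r q hq (by omega)
      (by rw [hR _ (by omega)]; omega) h1 h2 h7 hJ hx1 hx2 hexit) (by omega)
  | succ n ihn =>
    by_cases hrn : r + 1 ≤ n + 1
    swap
    · rw [if_neg hrn, combinations_eq_nil (by simp; omega), List.map_nil, List.nil_append]
      exact .mono (resumes_level_fail hS hN r q hq (by omega)
        (by rw [hR _ (by omega)]; omega) h1 h2 h7 hJ hx1 hx2 hexit) (by omega)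
    rw [if_pos hrn]
    -- The run from the increment of this loop on: it lists the combinations that do not use `lo`,
    -- and then `rest`.
    have htail : ∀ (reg' : ℕ → ℕ) (real' : ℕ → ℝ),
        (∀ i < 12 + 2 * q, i ≠ 5 → i ≠ 6 → reg' i = reg i) → real' 0 = x₁ → real' 1 = x₂ →
        Resumes (listingProgram ℓ) S w Δ
          ((if r + 1 ≤ n then 20 * (r + 1) else T + 12) + 2) ⟨30 + 16 * q + 14, reg', real', mem⟩
          ((combinations (r + 1) (List.range' (lo + 1) n)).map
            (fun js => pre ++ js.map (S.word · 0)) ++ rest) := by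
      intro reg' real' hreg hx1' hx2'
      have hreg' : ∀ i < 11 + 2 * q, i ≠ 5 → i ≠ 6 → reg' i = reg i :=
        fun i hi => hreg i (by omega)
      have hu : ∀ i < 11 + 2 * q, i ≠ 5 → i ≠ 6 →
          Function.update reg' (11 + 2 * q) (lo + 1) i = reg i := by
        intro i hi h5 h6
        rw [Function.update_of_ne hi.ne, hreg' i hi h5 h6]
      refine .add (hP 14 (by omega)) (lo + 1) ?_ (by omega) ?_
      · rw [hreg _ (by omega) (by omega) (by omega), hreg _ (by omega) (by omega) (by omega), hJ, h1]
      refine .jump (hP 15 (by omega)) ?_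
      refine ihn (lo + 1) (by omega) (fun p hp => hR p (by omega)) _ _ ?_ ?_ ?_ (by simp) hx1' hx2'
        ?_ ?_
      · rw [hu _ (by omega) (by omega) (by omega), h1]
      · rw [hu _ (by omega) (by omega) (by omega), h2]
      · rw [hu _ (by omega) (by omega) (by omega), h7]
      · rw [← hpre]
        refine List.map_congr_left fun i hi => hu _ ?_ (by omega) (by omega)
        have := List.mem_range.1 hi
        omega
      · intro reg'' real'' h
        exact hexit reg'' real'' fun i hi h5 h6 => (h i hi h5 h6).trans (hu i hi h5 h6)
    have hpre' : ∀ reg' : ℕ → ℕ, (∀ i < 12 + 2 * q, i ≠ 5 → i ≠ 6 → reg' i = reg i) →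
        reg' (12 + 2 * q) = S.word lo 0 →
        (List.range (q + 3)).map (fun i => reg' (8 + 2 * i)) = pre ++ [S.word lo 0] := by
      intro reg' hreg hid
      rw [List.range_succ, List.map_append, ← hpre]
      congr 1
      · refine List.map_congr_left fun i hi => hreg _ ?_ (by omega) (by omega)
        have := List.mem_range.1 hi
        omega
      · rw [List.map_singleton, show 8 + 2 * (q + 2) = 12 + 2 * q by ring, hid]
    rw [List.range'_succ, combinations, List.map_append, List.append_assoc]
    rcases r with _ | r
    · refine .mono (T := (0 + 1) + 10) (resumes_level_pass hS hN 0 q hq (by omega)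
        (by rw [hR _ (by omega)]; omega) h1 h2 h7 hJ hx1 hx2 ?_) (by omega)
      intro reg' real' hreg hid hx1' hx2'
      simp only [combinations, List.map_cons, List.map_nil, List.cons_append, List.nil_append]
      refine .report (by rw [hP 13 (by omega)]; simp only [levelCode, if_pos hq]; rfl) ?_
        ((htail reg' real' hreg hx1' hx2').mono (by split_ifs <;> omega))
      rw [List.map_map, ← hpre' reg' hreg hid, ← hq]
      rfl
    · refine .mono (T := (20 * (r + 1) + 1 + 1) + 10) (resumes_level_pass hS hN (r + 1) q hq
        (by omega) (by rw [hR _ (by omega)]; omega) h1 h2 h7 hJ hx1 hx2 ?_) (by omega)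
      intro reg' real' hreg hid hx1' hx2'
      refine .jump (by rw [hP 13 (by omega)]; simp only [levelCode, if_neg (show q + 2 ≠ ℓ by omega)]; rfl) ?_
      have hP' := fun i hi => listingProgram_level (ℓ := ℓ) (q := q + 1) (by omega) i hi
      refine .add (hP' 0 (by omega)) (lo + 1) ?_ (by omega) ?_
      · rw [show 9 + 2 * (q + 1) = 11 + 2 * q by ring, hreg _ (by omega) (by omega) (by omega),
          hreg _ (by omega) (by omega) (by omega), hJ, h1]
      have hu : ∀ i < 13 + 2 * q, Function.update reg' (11 + 2 * (q + 1)) (lo + 1) i = reg' i :=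
        fun i hi => Function.update_of_ne (by omega) _ _
      -- The next loop lists the combinations that start with `lo`; its exit is the increment of
      -- this loop, so `htail` serves as its continuation.
      have key := ih r (by omega) (q + 1) (by omega) n (lo + 1) (by omega)
        (fun p hp => hR p (by omega)) (Function.update reg' (11 + 2 * (q + 1)) (lo + 1)) real'
        (by rw [hu _ (by omega), hreg _ (by omega) (by omega) (by omega), h1])
        (by rw [hu _ (by omega), hreg _ (by omega) (by omega) (by omega), h2])
        (by rw [hu _ (by omega), hreg _ (by omega) (by omega) (by omega), h7])
        (by simp) hx1' hx2' (pre ++ [S.word lo 0])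
        (by
          rw [← hpre' reg' hreg hid]
          refine List.map_congr_left fun i hi => hu _ ?_
          have := List.mem_range.1 hi
          omega)
        _ ((if r + 1 + 1 ≤ n then 20 * (r + 1 + 1) else T + 12) + 2)
        (fun reg'' real'' h hx1'' hx2'' => by
          rw [show 28 + 16 * (q + 1) = 30 + 16 * q + 14 by ring]
          refine htail reg'' real'' (fun i hi h5 h6 => ?_) hx1'' hx2''
          rw [h i (by omega) h5 h6, hu i (by omega), hreg i hi h5 h6])
        (by split_ifs <;> omega) (by omega)
      rw [if_pos (by omega)] at key
      rw [List.map_map]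
      convert key using 3
      funext js
      simp

end Levels

/-! ### The tree of windows and its traversal -/

/-- A binary tree with leaves labelled by windows, which are given by their first positions. -/
inductive WindowTree where
  | leaf (j : ℕ)
  | node (l r : WindowTree)

namespace WindowTree

/-- The number of nodes. -/
def size : WindowTree → ℕ
  | leaf _ => 1
  | node l r => l.size + r.size + 1

/-- The depth. -/
def depth : WindowTree → ℕ
  | leaf _ => 0
  | node l r => max l.depth r.depth + 1

/-- The labels of the leaves, from left to right. -/
def leaves : WindowTree → List ℕ
  | leaf j => [j]
  | node l r => l.leaves ++ r.leaves

/-- The minimum of `b` over the leaves. -/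
noncomputable def minLeaf (b : ℕ → ℝ) : WindowTree → ℝ
  | leaf j => b j
  | node l r => min (l.minLeaf b) (r.minLeaf b)

/-- The data structure holds the tree in preorder in its records from number `p` on. -/
def Placed (S : Store) (a b : ℕ → ℝ) : WindowTree → ℕ → Prop
  | leaf j, p => S.word p 2 = 1 ∧ S.word p 3 = j ∧ S.realAt p 2 = b j ∧ S.realAt p 3 = a j
  | node l r, p => S.word p 2 = l.size + r.size + 1 ∧ S.realAt p 2 = min (l.minLeaf b) (r.minLeaf b) ∧
      l.Placed S a b (p + 1) ∧ r.Placed S a b (p + 1 + l.size)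

theorem size_pos (t : WindowTree) : 0 < t.size := by
  cases t <;> simp [size]

theorem lt_minLeaf {b : ℕ → ℝ} {x : ℝ} {t : WindowTree} :
    x < t.minLeaf b ↔ ∀ j ∈ t.leaves, x < b j := by
  induction t with
  | leaf j => simp [minLeaf, leaves]
  | node l r hl hr => simp [minLeaf, leaves, hl, hr, or_imp, forall_and]

end WindowTree

section Traversal

variable {ℓ : ℕ} {S : Store} {w Δ N : ℕ} {x₁ x₂ : ℝ} {mem : ℕ → ℕ} {a b : ℕ → ℝ}

/-- The output for a list of windows that is sorted by `a` in descending order: the traversal stops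
at the first window with `b` at most `x₂` and `a` less than `x₁`. -/
noncomputable def windowOutputs (a b : ℕ → ℝ) (x₁ x₂ : ℝ) (out : ℕ → List (List ℕ)) :
    List ℕ → List (List ℕ)
  | [] => []
  | j :: js =>
    if b j ≤ x₂ then if x₁ ≤ a j then out j ++ windowOutputs a b x₁ x₂ out js else []
    else windowOutputs a b x₁ x₂ out js

theorem windowOutputs_append_of_lt {out : ℕ → List (List ℕ)} {js js' : List ℕ}
    (h : ∀ j ∈ js, x₂ < b j) :
    windowOutputs a b x₁ x₂ out (js ++ js') = windowOutputs a b x₁ x₂ out js' := by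
  induction js with
  | nil => rfl
  | cons j js ih =>
    rw [List.cons_append, windowOutputs, if_neg (not_le.2 (h j (by simp))),
      ih fun i hi => h i (by simp [hi])]

/-- Stopping early loses nothing: once `a` has dropped below `x₁`, it stays below. -/
theorem windowOutputs_eq_flatMap {out : ℕ → List (List ℕ)} {js : List ℕ}
    (h : js.Pairwise fun i j => a j ≤ a i) :
    windowOutputs a b x₁ x₂ out js =
      (js.filter fun j => b j ≤ x₂ ∧ x₁ ≤ a j).flatMap out := by
  induction js with
  | nil => rfl
  | cons j js ih =>
    rw [List.pairwise_cons] at h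
    rw [windowOutputs, ih h.2]
    by_cases hb : b j ≤ x₂
    · by_cases ha : x₁ ≤ a j
      · simp [hb, ha]
      · have : ∀ i ∈ js, ¬ x₁ ≤ a i := fun i hi hx => ha (hx.trans (h.1 i hi))
        have hnil : (j :: js).filter (fun j => b j ≤ x₂ ∧ x₁ ≤ a j) = [] := by
          rw [List.filter_eq_nil_iff]
          intro i hi
          rcases List.mem_cons.1 hi with rfl | hi
          · simp [ha]
          · simp [this i hi]
        rw [hnil, if_pos hb, if_neg ha]
        rfl
    · simp [hb]

/-- The contents of the registers when the traversal arrives at the node `p`. -/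
structure AtNode (x₁ x₂ : ℝ) (p : ℕ) (reg : ℕ → ℕ) (real : ℕ → ℝ) : Prop where
  reg_zero : reg 0 = 0
  reg_one : reg 1 = 1
  reg_two : reg 2 = 4
  reg_three : reg 3 = p
  real_zero : real 0 = x₁
  real_one : real 1 = x₂

theorem resumes_skip (hS : S.Fits w) (hN : 4 * (N + ℓ) + 8 ≤ 2 ^ w) {p z : ℕ} (hz : S.word p 2 = z)
    (hz0 : 0 < z) (hpz : p + z ≤ N) (hx : x₂ < S.realAt p 2)
    {reg : ℕ → ℕ} {real : ℕ → ℝ} (h : AtNode x₁ x₂ p reg real) {T : ℕ} {rest : List (List ℕ)}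
    (hnext : ∀ (reg' : ℕ → ℕ) (real' : ℕ → ℝ), AtNode x₁ x₂ (p + z) reg' real' →
      Resumes (listingProgram ℓ) S w Δ T ⟨5, reg', real', mem⟩ rest) :
    Resumes (listingProgram ℓ) S w Δ (T + 9) ⟨5, reg, real, mem⟩ rest := by
  obtain ⟨h0, h1, h2, h3, hx1, hx2⟩ := h
  refine .mul rfl (4 * p) (by simp [h2, h3, Nat.mul_comm _ 4]) (by omega) ?_
  refine .add rfl (4 * p + 1) (by simp [h1]) (by omega) ?_
  refine .add rfl (4 * p + 2) (by simp [h1]) (by omega) ?_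
  refine .fetch hS rfl p 2 (by simp) ?_
  refine .jumpLe_false rfl (by simp [h0, hz, hz0.ne']) ?_
  refine .fetchReal rfl p 2 (by simp) ?_
  refine .jumpRealLe_false rfl (by simpa [hx2] using hx) ?_
  refine .add rfl (p + z) (by simp [h3, hz]) (by omega) ?_
  refine .jump rfl (hnext _ _ ⟨?_, ?_, ?_, ?_, ?_, ?_⟩) <;> simp [*]

theorem resumes_visit (hS : S.Fits w) (hN : 4 * (N + ℓ) + 8 ≤ 2 ^ w) {p z : ℕ} (hz : S.word p 2 = z)
    (hz0 : 0 < z) (hpz : p + z ≤ N) (hx : S.realAt p 2 ≤ x₂)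
    {reg : ℕ → ℕ} {real : ℕ → ℝ} (h : AtNode x₁ x₂ p reg real) {T : ℕ} {rest : List (List ℕ)}
    (hnext : ∀ (reg' : ℕ → ℕ) (real' : ℕ → ℝ), AtNode x₁ x₂ p reg' real' → reg' 4 = z →
      reg' 5 = 4 * p + 2 →
      Resumes (listingProgram ℓ) S w Δ T ⟨14, reg', real', mem⟩ rest) :
    Resumes (listingProgram ℓ) S w Δ (T + 7) ⟨5, reg, real, mem⟩ rest := by
  obtain ⟨h0, h1, h2, h3, hx1, hx2⟩ := h
  refine .mul rfl (4 * p) (by simp [h2, h3, Nat.mul_comm _ 4]) (by omega) ?_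
  refine .add rfl (4 * p + 1) (by simp [h1]) (by omega) ?_
  refine .add rfl (4 * p + 2) (by simp [h1]) (by omega) ?_
  refine .fetch hS rfl p 2 (by simp) ?_
  refine .jumpLe_false rfl (by simp [h0, hz, hz0.ne']) ?_
  refine .fetchReal rfl p 2 (by simp) ?_
  refine .jumpRealLe_true rfl (by simpa [hx2] using hx) ?_
  refine hnext _ _ ⟨?_, ?_, ?_, ?_, ?_, ?_⟩ ?_ ?_ <;> simp [*]

/-- The conditions on a window with `x₁ ≤ a j` and `b j ≤ x₂` under which the program outputs
`out j` for it: the darts that are a continuation of the position `j` are those before `R`. -/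
structure ProperWindow (S : Store) (ℓ N : ℕ) (x₂ : ℝ) (j R : ℕ) (out : List (List ℕ)) : Prop where
  le_bound : R ≤ N
  length_le : j + ℓ ≤ R
  iff_lt : ∀ p, j ≤ p → (S.word j 1 ≤ S.word p 1 ∧ S.realAt p 0 ≤ x₂ ↔ p < R)
  out_eq : out = (combinations (ℓ - 1) (List.range' (j + 1) (R - (j + 1)))).map
    (fun js => [S.word j 1 - 1, S.word j 0] ++ js.map (S.word · 0))

theorem resumes_window (hℓ : 2 ≤ ℓ) (hS : S.Fits w) (hN : 4 * (N + ℓ) + 8 ≤ 2 ^ w) {p j R : ℕ}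
    {out : List (List ℕ)} (hp : p < N) (hpj : S.word p 3 = j) (hj : ProperWindow S ℓ N x₂ j R out)
    (ha : x₁ ≤ S.realAt p 3)
    {reg : ℕ → ℕ} {real : ℕ → ℝ} (h : AtNode x₁ x₂ p reg real) (h4 : reg 4 = 1)
    (h5 : reg 5 = 4 * p + 2) {T : ℕ} {rest : List (List ℕ)}
    (hnext : ∀ (reg' : ℕ → ℕ) (real' : ℕ → ℝ), AtNode x₁ x₂ (p + 1) reg' real' →
      Resumes (listingProgram ℓ) S w Δ T ⟨5, reg', real', mem⟩ rest)
    (hT : T + 20 * ℓ + 2 ≤ Δ) (hΔ : 40 * ℓ ≤ Δ) :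
    Resumes (listingProgram ℓ) S w Δ (20 * ℓ) ⟨14, reg, real, mem⟩ (out ++ rest) := by
  obtain ⟨h0, h1, h2, h3, hx1, hx2⟩ := h
  obtain ⟨hRN, hjR, hR, rfl⟩ := hj
  have hP := fun i hi => listingProgram_level (ℓ := ℓ) (q := 0) (by omega) i hi
  refine .mono (T := 20 * (ℓ - 2 + 1) + 13) ?_ (by omega)
  refine .jumpLe_true rfl (by simp [h4, h1]) ?_
  refine .add rfl (4 * p + 3) (by simp [h5, h1]) (by omega) ?_
  refine .fetchReal rfl p 3 (by simp) ?_
  refine .jumpRealLe_true rfl (by simpa [hx1] using ha) ?_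
  refine .fetch hS rfl p 3 (by simp) ?_
  rw [hpj]
  refine .mul rfl (4 * j) (by simp [h2, Nat.mul_comm _ 4]) (by omega) ?_
  refine .fetch hS rfl j 0 (by simp) ?_
  refine .add rfl (4 * j + 1) (by simp [h1]) (by omega) ?_
  refine .fetch hS rfl j 1 (by simp) ?_
  refine .sub rfl (S.word j 1 - 1) (by simp [h1]) ?_ ?_
  · exact (Nat.sub_le _ _).trans_lt (hS.getD_lt _)
  refine .jump rfl ?_
  refine .add (hP 0 (by omega)) (j + 1) (by simp [h1]) (by omega) ?_
  have key := resumes_level (Δ := Δ) (x₁ := x₁) (mem := mem) hS hN hRN (ℓ - 2) 0 (by omega)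
    (R - (j + 1)) (j + 1) (by omega) (fun p hp => hR p (by omega))
  simp only [show ℓ - 2 + 1 = ℓ - 1 by omega, if_pos (show ℓ - 1 ≤ R - (j + 1) by omega)] at key
  rw [show ℓ - 2 + 1 = ℓ - 1 by omega]
  refine .mono (key _ _ ?_ ?_ ?_ ?_ ?_ ?_ _ ?_ rest (T + 2) ?_ ?_ ?_) (Nat.le_succ _)
  · simp [h1]
  · simp [h2]
  · simp
  · simp
  · simpa
  · simpa
  · simp [List.range_succ]
  · intro reg' real' hreg hx1' hx2'
    refine .add rfl (p + 1) ?_ (by omega) ?_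
    · rw [hreg 3 (by omega) (by omega) (by omega), hreg 1 (by omega) (by omega) (by omega)]
      simp [h1, h3]
    refine .jump rfl (hnext _ _ ⟨?_, ?_, ?_, ?_, hx1', hx2'⟩)
    · simp [hreg 0, h0]
    · simp [hreg 1, h1]
    · simp [hreg 2, h2]
    · simp
  · omega
  · omega

theorem resumes_skip_tree (hS : S.Fits w) (hN : 4 * (N + ℓ) + 8 ≤ 2 ^ w)
    {out : ℕ → List (List ℕ)} (t : WindowTree) (p : ℕ) (hz : S.word p 2 = t.size)
    (hm : S.realAt p 2 = t.minLeaf b) (hpN : p + t.size ≤ N) (hx : ¬ t.minLeaf b ≤ x₂)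
    (js : List ℕ) (T : ℕ)
    (hnext : ∀ (reg' : ℕ → ℕ) (real' : ℕ → ℝ), AtNode x₁ x₂ (p + t.size) reg' real' →
      Resumes (listingProgram ℓ) S w Δ T ⟨5, reg', real', mem⟩ (windowOutputs a b x₁ x₂ out js))
    (reg : ℕ → ℕ) (real : ℕ → ℝ) (h : AtNode x₁ x₂ p reg real) :
    Resumes (listingProgram ℓ) S w Δ (T + 20) ⟨5, reg, real, mem⟩
      (windowOutputs a b x₁ x₂ out (t.leaves ++ js)) := by
  rw [not_le] at hx
  rw [windowOutputs_append_of_lt (WindowTree.lt_minLeaf.1 hx)]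
  exact .mono (resumes_skip hS hN hz t.size_pos hpN (by rwa [hm]) h hnext) (by omega)

/-- If the minimum is at most `x₂`, some leaf below causes an output or the stop, so the first event
comes before the continuation is reached and its time `T` does not enter the bound. The reserve for
`d` in `hT` pays for the right siblings that may have to be skipped after the last output. -/
theorem resumes_tree (hℓ : 2 ≤ ℓ) (hS : S.Fits w) (hN : 4 * (N + ℓ) + 8 ≤ 2 ^ w)
    {out : ℕ → List (List ℕ)} (t : WindowTree) (d : ℕ) (hd : t.depth ≤ d) (p : ℕ)
    (ht : t.Placed S a b p) (hpN : p + t.size ≤ N)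
    (hout : ∀ j ∈ t.leaves, b j ≤ x₂ → x₁ ≤ a j → ∃ R, ProperWindow S ℓ N x₂ j R (out j))
    (js : List ℕ) (T : ℕ)
    (hnext : ∀ (reg' : ℕ → ℕ) (real' : ℕ → ℝ), AtNode x₁ x₂ (p + t.size) reg' real' →
      Resumes (listingProgram ℓ) S w Δ T ⟨5, reg', real', mem⟩ (windowOutputs a b x₁ x₂ out js))
    (hT : T + 20 * (d + ℓ + 2) ≤ Δ) (hΔ : 20 * (3 * d + 2 * ℓ + 5) ≤ Δ)
    (reg : ℕ → ℕ) (real : ℕ → ℝ) (h : AtNode x₁ x₂ p reg real) :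
    Resumes (listingProgram ℓ) S w Δ
      (if t.minLeaf b ≤ x₂ then 20 * (2 * d + ℓ + 2) else T + 20) ⟨5, reg, real, mem⟩
      (windowOutputs a b x₁ x₂ out (t.leaves ++ js)) := by
  induction t generalizing d p js T reg real with
  | leaf j =>
    obtain ⟨hz, hj, hb, ha⟩ := ht
    split_ifs with hx
    swap
    · exact resumes_skip_tree hS hN (.leaf j) p hz hb hpN hx js T hnext reg real h
    have hx' : b j ≤ x₂ := hx
    rw [WindowTree.leaves, List.singleton_append, windowOutputs, if_pos hx']
    split_ifs with ha'
    · obtain ⟨R, hR⟩ := hout j (by simp [WindowTree.leaves]) hx' ha'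
      refine .mono (T := 20 * ℓ + 7) (resumes_visit hS hN hz one_pos hpN (by rwa [hb]) h ?_)
        (by omega)
      intro reg' real' h' h4 h5
      have : p + 1 ≤ N := hpN
      exact resumes_window hℓ hS hN (by omega) hj hR (by rwa [ha]) h' h4 h5 hnext (by omega)
        (by omega)
    · refine .mono (T := (0 + 1) + 4 + 7)
        (resumes_visit hS hN hz one_pos hpN (by rwa [hb]) h ?_) (by omega)
      intro reg' real' ⟨h0, h1, h2, h3, hx1, hx2⟩ h4 h5
      have : p + 1 ≤ N := hpN
      refine .jumpLe_true rfl (by simp [h4, h1]) ?_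
      refine .add rfl (4 * p + 3) (by simp [h5, h1]) (by omega) ?_
      refine .fetchReal rfl p 3 (by simp) ?_
      refine .jumpRealLe_false rfl (by simpa [hx1, ha] using ha') ?_
      exact .halt rfl (by simpa)
  | node l r ihl ihr =>
    obtain ⟨hz, hm, hl, hr⟩ := ht
    split_ifs with hx
    swap
    · exact resumes_skip_tree hS hN (.node l r) p hz hm hpN hx js T hnext reg real h
    obtain ⟨d, rfl⟩ : ∃ d', d = d' + 1 := by
      cases d with
      | zero => simp [WindowTree.depth] at hd
      | succ d => exact ⟨d, rfl⟩
    simp only [WindowTree.depth, add_le_add_iff_right, max_le_iff] at hd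
    have hlr : p + (l.size + r.size + 1) ≤ N := hpN
    have hlpos := l.size_pos
    -- The right subtree is the continuation of the left one.
    have hright : ∀ (reg' : ℕ → ℕ) (real' : ℕ → ℝ), AtNode x₁ x₂ (p + 1 + l.size) reg' real' →
        Resumes (listingProgram ℓ) S w Δ
          (if r.minLeaf b ≤ x₂ then 20 * (2 * d + ℓ + 2) else T + 20) ⟨5, reg', real', mem⟩
          (windowOutputs a b x₁ x₂ out (r.leaves ++ js)) := by
      refine ihr d hd.2 _ hr (by omega) (fun j hj => hout j (by simp [WindowTree.leaves, hj])) js T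
        (fun reg' real' h' => hnext reg' real' ?_) (by omega) (by omega)
      rwa [WindowTree.size, show p + (l.size + r.size + 1) = p + 1 + l.size + r.size by ring]
    have hleft := ihl d hd.1 _ hl (by omega)
      (fun j hj => hout j (by simp [WindowTree.leaves, hj])) (r.leaves ++ js) _ hright
      (by split_ifs <;> omega) (by omega)
    refine .mono (T := (if l.minLeaf b ≤ x₂ then 20 * (2 * d + ℓ + 2) else
      (if r.minLeaf b ≤ x₂ then 20 * (2 * d + ℓ + 2) else T + 20) + 20) + 3 + 7)
        (resumes_visit hS hN hz (Nat.succ_pos _) hlr (by rwa [hm]) h ?_) ?_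
    · intro reg' real' ⟨h0, h1, h2, h3, hx1, hx2⟩ h4 h5
      refine .jumpLe_false rfl (by rw [h4, h1]; omega) ?_
      refine .add rfl (p + 1) (by simp [h3, h1]) (by omega) ?_
      refine .jump rfl ?_
      rw [WindowTree.leaves, List.append_assoc]
      exact hleft _ _ ⟨by simpa, by simpa, by simpa, by simp, hx1, hx2⟩
    -- If the left subtree is skipped, the right one must be entered, so a level costs at most one
    -- visit and one skip.
    · rw [WindowTree.minLeaf, min_le_iff] at hx
      by_cases hxl : l.minLeaf b ≤ x₂
      · rw [if_pos hxl]
        omega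
      · rw [if_neg hxl, if_pos (hx.resolve_left hxl)]
        omega

theorem resumes_end (hS : S.Fits w) (hN : 4 * (N + ℓ) + 8 ≤ 2 ^ w) {p : ℕ} (hp : p ≤ N)
    (hz : S.word p 2 = 0) {reg : ℕ → ℕ} {real : ℕ → ℝ} (h : AtNode x₁ x₂ p reg real) (T : ℕ) :
    Resumes (listingProgram ℓ) S w Δ (T + 6) ⟨5, reg, real, mem⟩ [] := by
  obtain ⟨h0, h1, h2, h3, -, -⟩ := h
  refine .mul rfl (4 * p) (by simp [h2, h3, Nat.mul_comm _ 4]) (by omega) ?_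
  refine .add rfl (4 * p + 1) (by simp [h1]) (by omega) ?_
  refine .add rfl (4 * p + 2) (by simp [h1]) (by omega) ?_
  refine .fetch hS rfl p 2 (by simp) ?_
  refine .jumpLe_true rfl (by simp [h0, hz]) ?_
  exact .halt rfl (by simpa)

theorem resumes_init (hw : 4 < 2 ^ w) {T : ℕ} {outs : List (List ℕ)}
    (hnext : ∀ (reg' : ℕ → ℕ) (real' : ℕ → ℝ), AtNode x₁ x₂ 0 reg' real' →
      Resumes (listingProgram ℓ) S w Δ T ⟨5, reg', real', fun _ => 0⟩ outs) :
    Resumes (listingProgram ℓ) S w Δ (T + 3) (State.init x₁ x₂) outs := by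
  refine .jump rfl ?_
  refine .const rfl (by omega) ?_
  refine .const rfl hw ?_
  exact hnext _ _ ⟨by simp, by simp, by simp, by simp, by simp, by simp⟩

theorem resumes_query_tree (hℓ : 2 ≤ ℓ) (hS : S.Fits w) (hN : 4 * (N + ℓ) + 8 ≤ 2 ^ w)
    {out : ℕ → List (List ℕ)} {t : WindowTree} (ht : t.Placed S a b 0) (htN : t.size ≤ N)
    (hz : S.word t.size 2 = 0)
    (hout : ∀ j ∈ t.leaves, b j ≤ x₂ → x₁ ≤ a j → ∃ R, ProperWindow S ℓ N x₂ j R (out j))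
    (hΔ : 20 * (3 * t.depth + 2 * ℓ + 5) ≤ Δ) :
    Resumes (listingProgram ℓ) S w Δ Δ (State.init x₁ x₂) (windowOutputs a b x₁ x₂ out t.leaves) := by
  refine .mono (resumes_init (by omega) fun reg real h => ?_) (T := 20 * (2 * t.depth + ℓ + 4) + 3)
    (by omega)
  have key := resumes_tree (Δ := Δ) (x₁ := x₁) (mem := fun _ => 0) hℓ hS hN t t.depth le_rfl 0 ht
    (by omega) hout [] (0 + 6)
    (fun reg' real' h' => resumes_end hS hN (by omega) (by simpa using hz) h' 0)
    (by omega) (by omega) reg real h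
  rw [List.append_nil] at key
  exact key.mono (by split_ifs <;> omega)

theorem resumes_query_empty (hN : 4 * (N + ℓ) + 8 ≤ 2 ^ w) (hΔ : 9 ≤ Δ) :
    Resumes (listingProgram ℓ) ⟨[], []⟩ w Δ Δ (State.init x₁ x₂) [] :=
  .mono (resumes_init (by omega) fun _ _ h =>
    resumes_end (T := 0) (by simp [Store.Fits]) hN (Nat.zero_le _) (by simp [Store.word]) h) hΔ

end Traversal

/-! ### The data structure -/

namespace WindowTree

variable {a b : ℕ → ℝ}

/-- Halve the list recursively; both halves are nonempty when the length is at least two. -/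
theorem exists_leaves_eq (d : ℕ) {l : List ℕ} (hl : l ≠ []) (hd : l.length ≤ 2 ^ d) :
    ∃ t : WindowTree, t.leaves = l ∧ t.depth ≤ d := by
  induction d generalizing l with
  | zero =>
    obtain ⟨j, rfl⟩ : ∃ j, l = [j] := by
      rw [← List.length_eq_one_iff]
      have := List.length_pos_iff.2 hl
      omega
    exact ⟨leaf j, rfl, le_rfl⟩
  | succ d ih =>
    have hpos := List.length_pos_iff.2 hl
    rw [pow_succ] at hd
    by_cases h1 : l.length = 1
    · obtain ⟨j, rfl⟩ := List.length_eq_one_iff.1 h1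
      exact ⟨leaf j, rfl, Nat.zero_le _⟩
    · obtain ⟨t₁, h₁, h₁'⟩ := ih (l := l.take (l.length / 2))
        (by rw [← List.length_pos_iff, List.length_take]; omega) (by rw [List.length_take]; omega)
      obtain ⟨t₂, h₂, h₂'⟩ := ih (l := l.drop (l.length / 2))
        (by rw [← List.length_pos_iff, List.length_drop]; omega) (by rw [List.length_drop]; omega)
      exact ⟨node t₁ t₂, by rw [leaves, h₁, h₂, List.take_append_drop], by simp [depth, h₁', h₂']⟩

theorem size_add_one (t : WindowTree) : t.size + 1 = 2 * t.leaves.length := by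
  induction t with
  | leaf j => rfl
  | node l r hl hr =>
    rw [size, leaves, List.length_append]
    omega

/-- The records of the nodes in preorder: subtree size, label, minimum of `b`, value of `a`. -/
noncomputable def records (a b : ℕ → ℝ) : WindowTree → List (ℕ × ℕ × ℝ × ℝ)
  | leaf j => [(1, j, b j, a j)]
  | node l r => (l.size + r.size + 1, 0, min (l.minLeaf b) (r.minLeaf b), 0) ::
      (l.records a b ++ r.records a b)

theorem length_records (t : WindowTree) : (t.records a b).length = t.size := by
  induction t with
  | leaf j => rfl
  | node l r hl hr => simp [records, size, hl, hr]

theorem records_bounds {t : WindowTree} {r : ℕ × ℕ × ℝ × ℝ} (hr : r ∈ t.records a b) :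
    r.1 ≤ t.size ∧ (r.2.1 = 0 ∨ r.2.1 ∈ t.leaves) := by
  induction t with
  | leaf j => simp_all [records, size, leaves]
  | node l r hl hr =>
    rw [records, List.mem_cons, List.mem_append] at hr
    rcases hr with rfl | h | h
    · simp [size]
    · obtain ⟨h1, h2⟩ := hl h
      simp only [size, leaves, List.mem_append]
      exact ⟨by omega, by tauto⟩
    · obtain ⟨h1, h2⟩ := hr h
      simp only [size, leaves, List.mem_append]
      exact ⟨by omega, by tauto⟩

theorem placed_of_records {S : Store} (t : WindowTree) (p : ℕ)
    (h : ∀ i r, (t.records a b)[i]? = some r → S.word (p + i) 2 = r.1 ∧ S.word (p + i) 3 = r.2.1 ∧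
      S.realAt (p + i) 2 = r.2.2.1 ∧ S.realAt (p + i) 3 = r.2.2.2) : t.Placed S a b p := by
  induction t generalizing p with
  | leaf j => exact h 0 _ rfl
  | node l r hl hr =>
    obtain ⟨h1, -, h3, -⟩ := h 0 _ rfl
    refine ⟨h1, h3, hl _ fun i x hi => ?_, hr _ fun i x hi => ?_⟩
    · rw [show p + 1 + i = p + (i + 1) by ring]
      refine h (i + 1) x ?_
      rw [records, List.getElem?_cons_succ, List.getElem?_append_left, hi]
      exact (List.getElem?_eq_some_iff.1 hi).1
    · rw [show p + 1 + l.size + i = p + (l.size + i + 1) by ring]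
      refine h (l.size + i + 1) x ?_
      rw [records, List.getElem?_cons_succ, ← length_records (a := a) (b := b) l,
        List.getElem?_append_right (Nat.le_add_right _ _), Nat.add_sub_cancel_left, hi]

end WindowTree

/-- The data structure with `N` records of four words and four real numbers each. -/
noncomputable def Store.ofFields (N : ℕ) (W : ℕ → ℕ → ℕ) (X : ℕ → ℕ → ℝ) : Store where
  words := (List.range (4 * N)).map fun k => W (k / 4) (k % 4)
  reals := (List.range (4 * N)).map fun k => X (k / 4) (k % 4)

section OfFields

variable {N : ℕ} {W : ℕ → ℕ → ℕ} {X : ℕ → ℕ → ℝ}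

theorem Store.space_ofFields : (Store.ofFields N W X).space = 8 * N := by
  simp [Store.space, Store.ofFields]
  ring

theorem Store.word_ofFields (hW : ∀ p x, N ≤ p → W p x = 0) (p : ℕ) {x : ℕ} (hx : x < 4) :
    (Store.ofFields N W X).word p x = W p x := by
  unfold Store.word Store.ofFields
  by_cases hp : p < N
  · rw [List.getD_eq_getElem _ _ (by simp; omega)]
    simp only [List.getElem_map, List.getElem_range]
    congr 1 <;> omega
  · rw [List.getD_eq_default _ _ (by simp; omega), hW _ _ (by omega)]

theorem Store.realAt_ofFields (hX : ∀ p x, N ≤ p → X p x = 0) (p : ℕ) {x : ℕ} (hx : x < 4) :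
    (Store.ofFields N W X).realAt p x = X p x := by
  unfold Store.realAt Store.ofFields
  by_cases hp : p < N
  · rw [List.getD_eq_getElem _ _ (by simp; omega)]
    simp only [List.getElem_map, List.getElem_range]
    congr 1 <;> omega
  · rw [List.getD_eq_default _ _ (by simp; omega), hX _ _ (by omega)]

theorem Store.fits_ofFields {w : ℕ} (hW : ∀ p x, W p x < 2 ^ w) :
    (Store.ofFields N W X).Fits w := by
  intro x hx
  obtain ⟨k, -, rfl⟩ := List.mem_map.1 hx
  exact hW _ _

end OfFields

/-! ### The sorted list of darts and its windows -/

section Darts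

variable {n ℓ : ℕ} {G : SimpleGraph (Fin n)} {A : Fin n → ℝ} {D : List (Fin n × Fin n)}
  {x₁ x₂ : ℝ}

/-- The darts of the graph, sorted by their first vertices in descending order, and for the same
first vertex by the attributes of their second vertices in ascending order. -/
structure IsDartList (G : SimpleGraph (Fin n)) (A : Fin n → ℝ) (D : List (Fin n × Fin n)) :
    Prop where
  mem_iff : ∀ v u, (v, u) ∈ D ↔ G.Adj v u
  nodup : D.Nodup
  pairwise : D.Pairwise fun d e => e.1 < d.1 ∨ d.1 = e.1 ∧ A d.2 ≤ A e.2
  length_eq : D.length = 2 * G.edgeSet.ncard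

theorem exists_isDartList (G : SimpleGraph (Fin n)) (A : Fin n → ℝ) : ∃ D, IsDartList G A D := by
  classical
  let r : Fin n × Fin n → Fin n × Fin n → Prop :=
    fun d e => e.1 < d.1 ∨ d.1 = e.1 ∧ A d.2 ≤ A e.2
  have : Std.Total r := ⟨fun d e => by
    rcases lt_trichotomy d.1 e.1 with h | h | h
    · exact .inr (.inl h)
    · rcases le_total (A d.2) (A e.2) with h' | h'
      · exact .inl (.inr ⟨h, h'⟩)
      · exact .inr (.inr ⟨h.symm, h'⟩)
    · exact .inl (.inl h)⟩
  have : IsTrans _ r := ⟨fun d e f => by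
    rintro (h | ⟨h, h'⟩) (k | ⟨k, k'⟩)
    · exact .inl (k.trans h)
    · exact .inl (k ▸ h)
    · exact .inl (h ▸ k)
    · exact .inr ⟨h.trans k, h'.trans k'⟩⟩
  let L : List (Fin n × Fin n) := (Finset.univ : Finset G.Dart).toList.map (·.toProd)
  refine ⟨L.insertionSort r, fun v u => ?_, ?_, List.pairwise_insertionSort r L, ?_⟩
  · rw [List.mem_insertionSort]
    simp only [L, List.mem_map, Finset.mem_toList, Finset.mem_univ, true_and]
    exact ⟨fun ⟨d, hd⟩ => by simpa [hd] using d.adj, fun h => ⟨⟨(v, u), h⟩, rfl⟩⟩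
  · rw [(List.perm_insertionSort r L).nodup_iff]
    exact (Finset.nodup_toList _).map SimpleGraph.Dart.toProd_injective
  · rw [List.length_insertionSort, List.length_map, Finset.length_toList, Finset.card_univ,
      G.dart_card_eq_twice_card_edges, Set.ncard_eq_toFinset_card', SimpleGraph.edgeFinset]

/-- One more than the first vertex of the dart number `p`, and zero if there is no such dart. -/
def centerKey (D : List (Fin n × Fin n)) (p : ℕ) : ℕ := D[p]?.elim 0 fun d => d.1 + 1

/-- The second vertex of the dart number `p`. -/
def leafId (D : List (Fin n × Fin n)) (p : ℕ) : ℕ := D[p]?.elim 0 fun d => d.2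

/-- The attribute of the first vertex of the dart number `p`. -/
def centerAttr (A : Fin n → ℝ) (D : List (Fin n × Fin n)) (p : ℕ) : ℝ := D[p]?.elim 0 fun d => A d.1

/-- The attribute of the second vertex of the dart number `p`. -/
def leafAttr (A : Fin n → ℝ) (D : List (Fin n × Fin n)) (p : ℕ) : ℝ := D[p]?.elim 0 fun d => A d.2

theorem centerKey_pos {p : ℕ} : 0 < centerKey D p ↔ p < D.length := by
  unfold centerKey
  rcases h : D[p]? with _ | d
  · simpa using h
  · simpa using (List.getElem?_eq_some_iff.1 h).1

theorem exists_of_centerKey_eq {p : ℕ} {v : Fin n} (h : centerKey D p = v + 1) :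
    ∃ u, D[p]? = some (v, u) := by
  unfold centerKey at h
  rcases hp : D[p]? with _ | ⟨v', u⟩
  · simp [hp] at h
  · have : v' = v := by simpa [hp, Fin.ext_iff] using h
    exact ⟨u, by rw [this]⟩

namespace IsDartList

theorem centerKey_le (hD : IsDartList G A D) {p q : ℕ} (hpq : p ≤ q) :
    centerKey D q ≤ centerKey D p := by
  rcases hpq.eq_or_lt with rfl | hpq
  · rfl
  by_cases hq : q < D.length
  · have := List.pairwise_iff_getElem.1 hD.pairwise p q (by omega) hq hpq
    simp only [centerKey, List.getElem?_eq_getElem hq,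
      List.getElem?_eq_getElem (show p < D.length by omega), Option.elim_some]
    rcases this with h | ⟨h, -⟩
    · have : ((D[q].1 : Fin n) : ℕ) < D[p].1 := h
      omega
    · rw [h]
  · have : centerKey D q = 0 := by simpa [hq] using (centerKey_pos (D := D) (p := q)).not
    omega

/-- Since keys descend along the list, the inequality `h` forces equal centers. It also forces `q`
to be a valid position, because the key behind the end is zero. -/
theorem leafAttr_le (hD : IsDartList G A D) {p q : ℕ} (hpq : p ≤ q) (hp : p < D.length)
    (h : centerKey D p ≤ centerKey D q) : leafAttr A D p ≤ leafAttr A D q := by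
  rcases hpq.eq_or_lt with rfl | hpq
  · rfl
  have hq : q < D.length := centerKey_pos.1 ((centerKey_pos.2 hp).trans_le h)
  have := List.pairwise_iff_getElem.1 hD.pairwise p q hp hq hpq
  simp only [centerKey, leafAttr, List.getElem?_eq_getElem hq,
    List.getElem?_eq_getElem hp, Option.elim_some] at h ⊢
  rcases this with h' | ⟨-, h'⟩
  · have : ((D[q].1 : Fin n) : ℕ) < D[p].1 := h'
    omega
  · exact h'

end IsDartList

/-- The smallest attribute in the star with `ℓ` consecutive leaves from position `j` on. -/
noncomputable def windowMin (A : Fin n → ℝ) (D : List (Fin n × Fin n)) (j : ℕ) : ℝ :=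
  min (centerAttr A D j) (leafAttr A D j)

/-- The largest attribute in the star with `ℓ` consecutive leaves from position `j` on. -/
noncomputable def windowMax (A : Fin n → ℝ) (D : List (Fin n × Fin n)) (ℓ j : ℕ) : ℝ :=
  max (centerAttr A D j) (leafAttr A D (j + ℓ - 1))

open Classical in
/-- The positions from which on there are `ℓ` darts from the same vertex, in descending order of
the smallest attribute. -/
noncomputable def windows (A : Fin n → ℝ) (D : List (Fin n × Fin n)) (ℓ : ℕ) : List ℕ :=
  ((List.range D.length).filter fun j => centerKey D j ≤ centerKey D (j + ℓ - 1)).insertionSort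
    fun i j => windowMin A D j ≤ windowMin A D i

theorem mem_windows {j : ℕ} :
    j ∈ windows A D ℓ ↔ j < D.length ∧ centerKey D j ≤ centerKey D (j + ℓ - 1) := by
  simp [windows]

theorem nodup_windows : (windows A D ℓ).Nodup := by
  classical
  unfold windows
  rw [(List.perm_insertionSort _ _).nodup_iff]
  exact List.nodup_range.filter _

theorem pairwise_windows :
    (windows A D ℓ).Pairwise fun i j => windowMin A D j ≤ windowMin A D i := by
  have : Std.Total fun i j => windowMin A D j ≤ windowMin A D i := ⟨fun i j => le_total _ _⟩
  have : IsTrans _ fun i j => windowMin A D j ≤ windowMin A D i := ⟨fun i j k h h' => h'.trans h⟩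
  exact List.pairwise_insertionSort _ _

theorem length_windows_le : (windows A D ℓ).length ≤ D.length := by
  rw [windows, List.length_insertionSort]
  exact (List.length_filter_le _ _).trans (by simp)

/-- From `j` on, the test for the same center and an attribute at most `x₂` is inherited by earlier
positions, so it holds on an initial segment. That segment contains the whole window because
`windowMax` is at most `x₂`. -/
theorem IsDartList.exists_bound (hD : IsDartList G A D) {j : ℕ} (hj : j ∈ windows A D ℓ)
    (hx : windowMax A D ℓ j ≤ x₂) : ∃ R ≤ D.length, j + ℓ ≤ R ∧
      ∀ p, j ≤ p → (centerKey D j ≤ centerKey D p ∧ leafAttr A D p ≤ x₂ ↔ p < R) := by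
  classical
  obtain ⟨hjD, hjw⟩ := mem_windows.1 hj
  have hpos := centerKey_pos.2 hjD
  have hlen : ¬ (centerKey D j ≤ centerKey D D.length ∧ leafAttr A D D.length ≤ x₂) := by
    rintro ⟨h, -⟩
    exact lt_irrefl _ (centerKey_pos.1 (hpos.trans_le h))
  have hdown : ∀ p q, j ≤ p → p ≤ q → centerKey D j ≤ centerKey D q ∧ leafAttr A D q ≤ x₂ →
      centerKey D j ≤ centerKey D p ∧ leafAttr A D p ≤ x₂ := by
    intro p q hjp hpq ⟨h1, h2⟩
    refine ⟨h1.trans (hD.centerKey_le hpq), (hD.leafAttr_le hpq ?_ ?_).trans h2⟩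
    · exact centerKey_pos.1 (hpos.trans_le (h1.trans (hD.centerKey_le hpq)))
    · exact (hD.centerKey_le hjp).trans h1
  have hex : ∃ p, j ≤ p ∧ ¬ (centerKey D j ≤ centerKey D p ∧ leafAttr A D p ≤ x₂) :=
    ⟨D.length, hjD.le, hlen⟩
  have hiff : ∀ p, j ≤ p →
      (centerKey D j ≤ centerKey D p ∧ leafAttr A D p ≤ x₂ ↔ p < Nat.find hex) := by
    intro p hp
    constructor
    · intro h
      by_contra hlt
      rw [not_lt] at hlt
      exact (Nat.find_spec hex).2 (hdown _ _ (Nat.find_spec hex).1 hlt h)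
    · intro h
      by_contra hn
      exact Nat.find_min hex h ⟨hp, hn⟩
  refine ⟨Nat.find hex, Nat.find_min' hex ⟨hjD.le, hlen⟩, ?_, hiff⟩
  -- For `ℓ = 0` the truncated `j + ℓ - 1` may lie before `j`, where `hiff` says nothing.
  by_cases hℓ : ℓ = 0
  · subst hℓ
    exact (Nat.find_spec hex).1
  · have := (hiff (j + ℓ - 1) (by omega)).1 ⟨hjw, (le_max_right _ _).trans hx⟩
    omega

/-- The list of the positions of the darts of an `ℓ`-star with all attributes in `[x₁, x₂]`. -/
def IsStar (A : Fin n → ℝ) (D : List (Fin n × Fin n)) (ℓ : ℕ) (x₁ x₂ : ℝ) (v : Fin n)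
    (js : List ℕ) : Prop :=
  js.length = ℓ ∧ js.Pairwise (· < ·) ∧ (x₁ ≤ A v ∧ A v ≤ x₂) ∧
    ∀ p ∈ js, ∃ u, D[p]? = some (v, u) ∧ x₁ ≤ A u ∧ A u ≤ x₂

theorem exists_mem_ge_of_pairwise_lt {j : ℕ} {js : List ℕ} (h : (j :: js).Pairwise (· < ·)) :
    ∃ p ∈ j :: js, j + js.length ≤ p := by
  induction js generalizing j with
  | nil => exact ⟨j, by simp⟩
  | cons i js ih =>
    obtain ⟨p, hp, hle⟩ := ih (List.pairwise_cons.1 h).2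
    have : j < i := (List.pairwise_cons.1 h).1 i (by simp)
    exact ⟨p, List.mem_cons_of_mem _ hp, by rw [List.length_cons]; omega⟩

theorem sublist_of_pairwise_lt {l l' : List ℕ} (hl : l.Pairwise (· < ·)) (hl' : l'.Pairwise (· < ·))
    (h : l ⊆ l') : l.Sublist l' :=
  List.sublist_of_subperm_of_pairwise (r := (· < ·)) (List.subperm_of_subset hl.nodup h) hl hl'

open Classical in
/-- The position lists of the stars, in the order in which they are listed. -/
noncomputable def starPositions (A : Fin n → ℝ) (D : List (Fin n × Fin n)) (ℓ : ℕ) (x₁ x₂ : ℝ)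
    (R : ℕ → ℕ) : List (List ℕ) :=
  ((windows A D ℓ).filter fun j => windowMax A D ℓ j ≤ x₂ ∧ x₁ ≤ windowMin A D j).flatMap
    fun j => (combinations (ℓ - 1) (List.range' (j + 1) (R j - (j + 1)))).map (j :: ·)

theorem nodup_starPositions {R : ℕ → ℕ} : (starPositions A D ℓ x₁ x₂ R).Nodup := by
  unfold starPositions
  rw [List.nodup_flatMap]
  refine ⟨fun j _ => (nodup_combinations _ List.nodup_range').map
    fun _ _ h => (List.cons.inj h).2, ?_⟩
  refine (nodup_windows.filter _).imp fun {i j} hij => ?_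
  simp only [Function.onFun, List.disjoint_left, List.mem_map]
  rintro _ ⟨l, -, rfl⟩ ⟨l', -, h⟩
  exact hij (List.cons.inj h).1.symm

/-- Leaf attributes ascend from `j` on, so the lower bound needs checking only at `j` and at the
center. Conversely, a star with first position `j` has a position at or after `j + ℓ - 1`, so by
monotonicity the window at `j` qualifies. -/
theorem IsDartList.mem_starPositions (hD : IsDartList G A D) (hℓ : 2 ≤ ℓ) {R : ℕ → ℕ}
    (hR : ∀ j ∈ windows A D ℓ, windowMax A D ℓ j ≤ x₂ →
      ∀ p, j ≤ p → (centerKey D j ≤ centerKey D p ∧ leafAttr A D p ≤ x₂ ↔ p < R j)) {js : List ℕ} :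
    js ∈ starPositions A D ℓ x₁ x₂ R ↔ ∃ v, IsStar A D ℓ x₁ x₂ v js := by
  simp only [starPositions, List.mem_flatMap, List.mem_filter, List.mem_map, mem_combinations,
    decide_eq_true_eq]
  constructor
  · rintro ⟨j, ⟨hj, hmax, hmin⟩, l, ⟨hl, hlen⟩, rfl⟩
    have hjR := hR j hj hmax
    obtain ⟨hjD, hjw⟩ := mem_windows.1 hj
    have hmem : ∀ p ∈ l, j < p ∧ p < R j := by
      intro p hp
      have := hl.subset hp
      rw [List.mem_range'_1] at this
      omega
    obtain ⟨⟨v, u⟩, hvu⟩ : ∃ d, D[j]? = some d := ⟨_, List.getElem?_eq_getElem hjD⟩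
    have hkey : centerKey D j = v + 1 := by simp [centerKey, hvu]
    have hcen : centerAttr A D j = A v := by simp [centerAttr, hvu]
    have hall : ∀ p, j ≤ p → p < R j → ∃ u, D[p]? = some (v, u) ∧ x₁ ≤ A u ∧ A u ≤ x₂ := by
      intro p hjp hpR
      obtain ⟨h1, h2⟩ := (hjR p hjp).2 hpR
      obtain ⟨u', hu'⟩ := exists_of_centerKey_eq ((h1.antisymm (hD.centerKey_le hjp)).symm.trans hkey)
      have hattr : leafAttr A D p = A u' := by simp [leafAttr, hu']
      refine ⟨u', hu', ?_, hattr ▸ h2⟩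
      rw [← hattr]
      exact (hmin.trans (min_le_right _ _)).trans (hD.leafAttr_le hjp hjD h1)
    have hjR' : j < R j := by
      refine (hjR j le_rfl).1 ⟨le_rfl, (hD.leafAttr_le (by omega) hjD hjw).trans
        ((le_max_right _ _).trans hmax)⟩
    refine ⟨v, by simp; omega, ?_, ?_, ?_⟩
    · rw [List.pairwise_cons]
      exact ⟨fun p hp => (hmem p hp).1, List.Pairwise.sublist hl List.pairwise_lt_range'⟩
    · rw [← hcen]
      exact ⟨hmin.trans (min_le_left _ _), (le_max_left _ _).trans hmax⟩
    · intro p hp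
      rcases List.mem_cons.1 hp with rfl | hp
      · exact hall _ le_rfl hjR'
      · exact hall _ (hmem p hp).1.le (hmem p hp).2
  · rintro ⟨v, hlen, hsort, hv, hall⟩
    obtain ⟨j, l, rfl⟩ : ∃ j l, js = j :: l := List.exists_cons_of_length_pos (by omega)
    rw [List.length_cons] at hlen
    obtain ⟨u, hju, hu1, hu2⟩ := hall j (by simp)
    obtain ⟨hjD, -⟩ := List.getElem?_eq_some_iff.1 hju
    have hkey : ∀ p ∈ j :: l, centerKey D p = v + 1 := by
      intro p hp
      obtain ⟨u, hu, -⟩ := hall p hp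
      simp [centerKey, hu]
    have hattr : ∀ p ∈ j :: l, leafAttr A D p ≤ x₂ := by
      intro p hp
      obtain ⟨u, hu, -, h⟩ := hall p hp
      simpa [leafAttr, hu] using h
    obtain ⟨q, hq, hjq⟩ := exists_mem_ge_of_pairwise_lt hsort
    have hw : centerKey D j ≤ centerKey D (j + ℓ - 1) := by
      rw [hkey j (by simp), ← hkey q hq]
      exact hD.centerKey_le (by omega)
    have hj : j ∈ windows A D ℓ := mem_windows.2 ⟨hjD, hw⟩
    have hmax : windowMax A D ℓ j ≤ x₂ := by
      refine max_le (by simpa [centerAttr, hju] using hv.2) ?_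
      refine (hD.leafAttr_le (show j + ℓ - 1 ≤ q by omega) ?_ ?_).trans (hattr q hq)
      · exact centerKey_pos.1 ((centerKey_pos.2 hjD).trans_le hw)
      · rw [hkey q hq, ← hkey j (by simp)]
        exact hD.centerKey_le (by omega)
    have hmin : x₁ ≤ windowMin A D j :=
      le_min (by simpa [centerAttr, hju] using hv.1) (by simpa [leafAttr, hju] using hu1)
    refine ⟨j, ⟨hj, hmax, hmin⟩, l, ⟨?_, by omega⟩, rfl⟩
    rw [List.pairwise_cons] at hsort
    refine sublist_of_pairwise_lt hsort.2 List.pairwise_lt_range' fun p hp => ?_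
    have hlt := hsort.1 p hp
    have := (hR j hj hmax p hlt.le).1 ⟨by rw [hkey j (by simp), hkey p (by simp [hp])],
      hattr p (by simp [hp])⟩
    rw [List.mem_range'_1]
    omega

end Darts

/-! ### Stars as copies of the pattern -/

section Stars

variable {n ℓ : ℕ} {G : SimpleGraph (Fin n)} {A : Fin n → ℝ} {D : List (Fin n × Fin n)}
  {x₁ x₂ : ℝ}

theorem starPattern_adj {i j : Fin (ℓ + 1)} :
    (starPattern ℓ).Adj i j ↔ i ≠ j ∧ (i = 0 ∨ j = 0) := SimpleGraph.starGraph_adj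

/-- The star with the given center and leaves. -/
def starCopy (v : Fin n) (u : Fin ℓ → Fin n) (hu : Function.Injective u) (h : ∀ i, G.Adj v (u i)) :
    SimpleGraph.Copy (starPattern ℓ) G where
  toHom :=
    { toFun := Fin.cons v u
      map_rel' := by
        intro i j hij
        obtain ⟨hne, rfl | rfl⟩ := starPattern_adj.1 hij
        · obtain ⟨k, rfl⟩ := Fin.exists_succ_eq.2 hne.symm
          exact h k
        · obtain ⟨k, rfl⟩ := Fin.exists_succ_eq.2 hne
          exact (h k).symm }
  injective' := Fin.cons_injective_iff.2 ⟨fun ⟨i, hi⟩ => (hi ▸ h i).ne rfl, hu⟩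

theorem copy_adj (f : SimpleGraph.Copy (starPattern ℓ) G) (i : Fin ℓ) : G.Adj (f 0) (f i.succ) :=
  f.toHom.map_rel (starPattern_adj.2 ⟨(Fin.succ_ne_zero i).symm, .inl rfl⟩)

theorem copy_adj_iff (f : SimpleGraph.Copy (starPattern ℓ) G) {x y : Fin n} :
    f.toSubgraph.Adj x y ↔
      ∃ i : Fin ℓ, x = f 0 ∧ y = f i.succ ∨ y = f 0 ∧ x = f i.succ := by
  simp only [SimpleGraph.Subgraph.map_adj, Relation.Map, SimpleGraph.Subgraph.top_adj,
    starPattern_adj]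
  constructor
  · rintro ⟨i, j, ⟨hne, rfl | rfl⟩, rfl, rfl⟩
    · obtain ⟨k, rfl⟩ := Fin.exists_succ_eq.2 hne.symm
      exact ⟨k, .inl ⟨rfl, rfl⟩⟩
    · obtain ⟨k, rfl⟩ := Fin.exists_succ_eq.2 hne
      exact ⟨k, .inr ⟨rfl, rfl⟩⟩
  · rintro ⟨i, ⟨rfl, rfl⟩ | ⟨rfl, rfl⟩⟩
    · exact ⟨0, i.succ, ⟨(Fin.succ_ne_zero i).symm, .inl rfl⟩, rfl, rfl⟩
    · exact ⟨i.succ, 0, ⟨Fin.succ_ne_zero i, .inr rfl⟩, rfl, rfl⟩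

theorem copy_verts (f : SimpleGraph.Copy (starPattern ℓ) G) {x : Fin n} :
    x ∈ f.toSubgraph.verts ↔ x = f 0 ∨ ∃ i : Fin ℓ, x = f i.succ := by
  simp only [SimpleGraph.Subgraph.map_verts, SimpleGraph.Subgraph.verts_top, Set.image_univ,
    Set.mem_range, Fin.exists_fin_succ, eq_comm (a := x)]
  rfl

theorem copy_toSubgraph_eq {f g : SimpleGraph.Copy (starPattern ℓ) G} (h0 : f 0 = g 0)
    (h : ∀ x, (∃ i : Fin ℓ, f i.succ = x) ↔ ∃ i : Fin ℓ, g i.succ = x) :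
    f.toSubgraph = g.toSubgraph := by
  ext x y
  · rw [copy_verts, copy_verts, h0]
    simp only [@eq_comm _ x, h]
  · rw [copy_adj_iff, copy_adj_iff, h0]
    simp only [exists_or, exists_and_left, @eq_comm _ x, @eq_comm _ y, h]

/-- If the centers differed, `f 0` would be a leaf of the other star, whose only neighbor is `g 0`;
but `f 0` has two distinct neighbors. -/
theorem copy_center_eq (hℓ : 2 ≤ ℓ) {f g : SimpleGraph.Copy (starPattern ℓ) G}
    (h : f.toSubgraph = g.toSubgraph) : f 0 = g 0 := by
  have hadj : ∀ i : Fin ℓ, g.toSubgraph.Adj (f 0) (f i.succ) := fun i => by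
    rw [← h, copy_adj_iff]
    exact ⟨i, .inl ⟨rfl, rfl⟩⟩
  by_contra hne
  have key : ∀ i : Fin ℓ, f i.succ = g 0 := fun i => by
    obtain ⟨k, ⟨h1, -⟩ | ⟨h1, -⟩⟩ := (copy_adj_iff g).1 (hadj i)
    · exact absurd h1 hne
    · exact h1
  have := Fin.succ_injective _ (f.injective ((key ⟨0, by omega⟩).trans (key ⟨1, by omega⟩).symm))
  simp at this

theorem copy_leaf_iff (hℓ : 2 ≤ ℓ) {f g : SimpleGraph.Copy (starPattern ℓ) G}
    (h : f.toSubgraph = g.toSubgraph) (x : Fin n) :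
    (∃ i : Fin ℓ, f i.succ = x) ↔ ∃ i : Fin ℓ, g i.succ = x := by
  have hc := copy_center_eq hℓ h
  have aux : ∀ f : SimpleGraph.Copy (starPattern ℓ) G,
      (∃ i : Fin ℓ, f i.succ = x) ↔ f.toSubgraph.Adj (f 0) x := by
    intro f
    rw [copy_adj_iff]
    constructor
    · rintro ⟨i, rfl⟩
      exact ⟨i, .inl ⟨rfl, rfl⟩⟩
    · rintro ⟨i, ⟨-, h⟩ | ⟨-, h⟩⟩
      · exact ⟨i, h.symm⟩
      · exact absurd (f.injective h) (Fin.succ_ne_zero i).symm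
  rw [aux, aux, h, hc]

theorem copy_mem_occurrences {f : SimpleGraph.Copy (starPattern ℓ) G} :
    f.toSubgraph ∈ occurrences (starPattern ℓ) G A x₁ x₂ ↔ ∀ i, x₁ ≤ A (f i) ∧ A (f i) ≤ x₂ := by
  have hmem : ∀ i, f i ∈ f.toSubgraph.verts := fun i => by simp
  constructor
  · rintro ⟨h, -⟩ i
    exact h.1 (hmem i)
  · refine fun h => ⟨⟨?_, ?_⟩, ⟨f.isoToSubgraph⟩⟩
    · rintro x ⟨i, -, rfl⟩
      exact h i
    · intro x y hxy
      have hx := f.toSubgraph.edge_vert hxy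
      have hy := f.toSubgraph.edge_vert hxy.symm
      obtain ⟨i, -, rfl⟩ := hx
      obtain ⟨j, -, rfl⟩ := hy
      exact ⟨h i, h j, f.toSubgraph.adj_sub hxy⟩

theorem exists_copy_of_mem_occurrences {H : G.Subgraph}
    (hH : H ∈ occurrences (starPattern ℓ) G A x₁ x₂) :
    ∃ f : SimpleGraph.Copy (starPattern ℓ) G, f.toSubgraph = H := by
  have : H ∈ Set.range (SimpleGraph.Copy.toSubgraph (A := starPattern ℓ) (B := G)) := by
    rw [SimpleGraph.Copy.range_toSubgraph]
    exact hH.2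
  exact this

/-- The output for the star with the given list of positions of darts. -/
def starTuple (D : List (Fin n × Fin n)) (js : List ℕ) : List ℕ :=
  (centerKey D (js.headD 0) - 1) :: js.map (leafId D)

theorem IsStar.starTuple_eq {v : Fin n} {js : List ℕ} (hℓ : 2 ≤ ℓ) (h : IsStar A D ℓ x₁ x₂ v js) :
    starTuple D js = (v : ℕ) :: js.map (leafId D) := by
  obtain ⟨hlen, -, -, hall⟩ := h
  obtain ⟨j, l, rfl⟩ : ∃ j l, js = j :: l := List.exists_cons_of_length_pos (by omega)
  obtain ⟨u, hu, -⟩ := hall j (by simp)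
  simp [starTuple, centerKey, hu]

theorem copy_tuple_eq_iff {f : SimpleGraph.Copy (starPattern ℓ) G} {v : Fin n} {l : List ℕ} :
    (v : ℕ) :: l = List.ofFn (fun i => (f i : ℕ)) ↔
      v = f 0 ∧ l = List.ofFn fun i : Fin ℓ => (f i.succ : ℕ) := by
  rw [List.ofFn_succ, List.cons.injEq, Fin.val_inj]

theorem IsDartList.eq_of_leafId_eq (hD : IsDartList G A D) {v u u' : Fin n} {p q : ℕ}
    (hp : D[p]? = some (v, u)) (hq : D[q]? = some (v, u')) (h : leafId D p = leafId D q) :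
    p = q := by
  have : u = u' := by simpa [leafId, hp, hq, Fin.val_inj] using h
  subst this
  exact (List.getElem?_inj (List.getElem?_eq_some_iff.1 hp).1 hD.nodup).1 (hp.trans hq.symm)

theorem IsDartList.exists_copy (hD : IsDartList G A D) (hℓ : 2 ≤ ℓ) {v : Fin n} {js : List ℕ}
    (h : IsStar A D ℓ x₁ x₂ v js) :
    ∃ f : SimpleGraph.Copy (starPattern ℓ) G, starTuple D js = List.ofFn (fun i => (f i : ℕ)) ∧
      f.toSubgraph ∈ occurrences (starPattern ℓ) G A x₁ x₂ := by
  rw [h.starTuple_eq hℓ]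
  obtain ⟨hlen, hsort, hv, hall⟩ := h
  have hall' : ∀ i : Fin ℓ, ∃ u, D[js[i]]? = some (v, u) ∧ x₁ ≤ A u ∧ A u ≤ x₂ :=
    fun i => hall _ (List.getElem_mem _)
  choose u hu hux using hall'
  have hid : ∀ i : Fin ℓ, leafId D js[i] = u i := fun i => by rw [leafId, hu i]; rfl
  have hinj : Function.Injective u := by
    intro i k hik
    have := hD.eq_of_leafId_eq (hu i) (hu k) (by rw [hid, hid, hik])
    have := (hsort.nodup.getElem_inj_iff).1 this
    exact Fin.ext this
  refine ⟨starCopy v u hinj fun i => (hD.mem_iff _ _).1 (List.mem_of_getElem? (hu i)),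
    copy_tuple_eq_iff.2 ⟨rfl, ?_⟩, copy_mem_occurrences.2 fun i => ?_⟩
  · refine List.ext_getElem (by simp [hlen]) fun i h1 h2 => ?_
    rw [List.getElem_map, List.getElem_ofFn]
    exact hid ⟨i, by simpa using h2⟩
  · refine Fin.cases hv (fun i => hux i) i

/-- The subgraph determines the center and the set of leaves, and a center with a leaf determines a
single position because darts do not repeat. Both lists ascend, so equal sets of positions mean
equal lists. -/
theorem IsDartList.eq_of_copy (hD : IsDartList G A D) (hℓ : 2 ≤ ℓ) {v v' : Fin n} {js js' : List ℕ}
    (h : IsStar A D ℓ x₁ x₂ v js) (h' : IsStar A D ℓ x₁ x₂ v' js')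
    {f f' : SimpleGraph.Copy (starPattern ℓ) G}
    (hf : starTuple D js = List.ofFn (fun i => (f i : ℕ)))
    (hf' : starTuple D js' = List.ofFn (fun i => (f' i : ℕ)))
    (hff : f.toSubgraph = f'.toSubgraph) : js = js' := by
  rw [h.starTuple_eq hℓ, copy_tuple_eq_iff] at hf
  rw [h'.starTuple_eq hℓ, copy_tuple_eq_iff] at hf'
  have hvv : v = v' := by rw [hf.1, hf'.1, copy_center_eq hℓ hff]
  subst hvv
  have aux : ∀ {js js' : List ℕ} {f f' : SimpleGraph.Copy (starPattern ℓ) G},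
      IsStar A D ℓ x₁ x₂ v js → IsStar A D ℓ x₁ x₂ v js' →
      js.map (leafId D) = List.ofFn (fun i : Fin ℓ => (f i.succ : ℕ)) →
      js'.map (leafId D) = List.ofFn (fun i : Fin ℓ => (f' i.succ : ℕ)) →
      f.toSubgraph = f'.toSubgraph → js ⊆ js' := by
    intro js js' f f' h h' hf hf' hff p hp
    have h1 : leafId D p ∈ js.map (leafId D) := List.mem_map_of_mem hp
    rw [hf, List.mem_ofFn] at h1
    obtain ⟨i, hi⟩ := h1
    obtain ⟨k, hk⟩ := (copy_leaf_iff hℓ hff _).1 ⟨i, rfl⟩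
    have h2 : leafId D p ∈ js'.map (leafId D) := by
      rw [hf', List.mem_ofFn]
      exact ⟨k, by simp only [hk]; exact hi⟩
    obtain ⟨q, hq, hqp⟩ := List.mem_map.1 h2
    obtain ⟨u, hu, -⟩ := h.2.2.2 p hp
    obtain ⟨u', hu', -⟩ := h'.2.2.2 q hq
    rwa [hD.eq_of_leafId_eq hu hu' hqp.symm]
  exact List.Subset.antisymm_of_pairwise h.2.1 h'.2.1 (aux h h' hf.2 hf'.2 hff)
    (aux h' h hf'.2 hf.2 hff.symm)

theorem IsDartList.exists_isStar (hD : IsDartList G A D) (hℓ : 2 ≤ ℓ) {H : G.Subgraph}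
    (hH : H ∈ occurrences (starPattern ℓ) G A x₁ x₂) :
    ∃ v js, IsStar A D ℓ x₁ x₂ v js ∧ Describes (starPattern ℓ) (starTuple D js) H := by
  obtain ⟨f, rfl⟩ := exists_copy_of_mem_occurrences hH
  have hx := copy_mem_occurrences.1 hH
  have hpos : ∀ i : Fin ℓ, ∃ p, D[p]? = some (f 0, f i.succ) := fun i =>
    List.mem_iff_getElem?.1 ((hD.mem_iff _ _).2 (copy_adj f i))
  choose pos hpos using hpos
  have hinj : Function.Injective pos := by
    intro i k hik
    have := hpos i
    rw [hik, hpos k, Option.some_inj, Prod.mk.injEq] at this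
    exact (Fin.succ_injective _ (f.injective this.2)).symm
  -- The copy may number its leaves in any order; sorting the positions selects the numbering that
  -- the program outputs.
  let js := (Finset.univ.image pos).sort (· ≤ ·)
  have hmem : ∀ p, p ∈ js ↔ ∃ i, pos i = p := fun p => by simp [js]
  have hstar : IsStar A D ℓ x₁ x₂ (f 0) js := by
    refine ⟨?_, ?_, hx 0, fun p hp => ?_⟩
    · rw [Finset.length_sort, Finset.card_image_of_injective _ hinj]
      simp
    · exact (Finset.sortedLT_sort _).pairwise
    · obtain ⟨i, rfl⟩ := (hmem p).1 hp
      exact ⟨_, hpos i, hx _⟩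
  obtain ⟨g, hg, -⟩ := hD.exists_copy hℓ hstar
  refine ⟨f 0, js, hstar, g, hg, ?_⟩
  rw [hstar.starTuple_eq hℓ, copy_tuple_eq_iff] at hg
  refine copy_toSubgraph_eq hg.1.symm fun x => ?_
  have h1 : (∃ i : Fin ℓ, g i.succ = x) ↔ (x : ℕ) ∈ js.map (leafId D) := by
    rw [hg.2, List.mem_ofFn]
    simp only [Fin.val_inj]
  rw [h1, List.mem_map]
  constructor
  · rintro ⟨p, hp, hpx⟩
    obtain ⟨i, rfl⟩ := (hmem p).1 hp
    exact ⟨i, by simpa [leafId, hpos i, Fin.val_inj] using hpx⟩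
  · rintro ⟨i, rfl⟩
    exact ⟨pos i, (hmem _).2 ⟨i, rfl⟩, by simp [leafId, hpos i]⟩

/-- A tuple determines the copy and hence the subgraph, so choosing a described subgraph for each
element of `l` involves no freedom; `h3` makes this choice injective. -/
theorem describesAllOnce_map {k : ℕ} {Q : SimpleGraph (Fin k)} {X : Set G.Subgraph} {α : Type*}
    {l : List α} {o : α → List ℕ} (hl : l.Nodup) (h1 : ∀ x ∈ l, ∃ H ∈ X, Describes Q (o x) H)
    (h2 : ∀ H ∈ X, ∃ x ∈ l, Describes Q (o x) H)
    (h3 : ∀ x ∈ l, ∀ y ∈ l, ∀ H : G.Subgraph, Describes Q (o x) H → Describes Q (o y) H → x = y) :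
    DescribesAllOnce Q (l.map o) X := by
  classical
  have huniq : ∀ {o : List ℕ} {H H' : G.Subgraph}, Describes Q o H → Describes Q o H' → H = H' := by
    rintro o H H' ⟨f, hf, rfl⟩ ⟨g, hg, rfl⟩
    have : f = g := by
      ext i
      have := congrFun (List.ofFn_injective (hf.symm.trans hg)) i
      exact this
    rw [this]
  choose! F hFX hF using h1
  refine ⟨l.map F, hl.map_on fun x hx y hy hxy => ?_, fun H => ?_, ?_⟩
  · exact h3 x hx y hy (F x) (hF x hx) (hxy ▸ hF y hy)
  · rw [List.mem_map]
    constructor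
    · rintro ⟨x, hx, rfl⟩
      exact hFX x hx
    · intro hH
      obtain ⟨x, hx, hxH⟩ := h2 H hH
      exact ⟨x, hx, huniq (hF x hx) hxH⟩
  · rw [List.forall₂_map_left_iff, List.forall₂_map_right_iff, List.forall₂_same]
    exact hF

theorem IsDartList.describesAllOnce (hD : IsDartList G A D) (hℓ : 2 ≤ ℓ) {l : List (List ℕ)}
    (hl : l.Nodup) (hmem : ∀ js, js ∈ l ↔ ∃ v, IsStar A D ℓ x₁ x₂ v js) :
    DescribesAllOnce (starPattern ℓ) (l.map (starTuple D))
      (occurrences (starPattern ℓ) G A x₁ x₂) := by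
  refine describesAllOnce_map hl (fun js hjs => ?_) (fun H hH => ?_) ?_
  · obtain ⟨v, hv⟩ := (hmem js).1 hjs
    obtain ⟨f, hf, hfX⟩ := hD.exists_copy hℓ hv
    exact ⟨_, hfX, f, hf, rfl⟩
  · obtain ⟨v, js, hjs, h⟩ := hD.exists_isStar hℓ hH
    exact ⟨js, (hmem js).2 ⟨v, hjs⟩, h⟩
  · rintro js hjs js' hjs' H ⟨f, hf, rfl⟩ ⟨f', hf', hff⟩
    obtain ⟨v, hv⟩ := (hmem js).1 hjs
    obtain ⟨v', hv'⟩ := (hmem js').1 hjs'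
    exact hD.eq_of_copy hℓ hv hv' hf hf' hff.symm

end Stars

/-! ### The data structure for stars -/

section StarStore

variable {n ℓ : ℕ} {G : SimpleGraph (Fin n)} {A : Fin n → ℝ} {D : List (Fin n × Fin n)}

/-- The word fields: leaf and center of a dart, subtree size and label of a node. -/
noncomputable def starWords (A : Fin n → ℝ) (D : List (Fin n × Fin n)) (ℓ : ℕ) (t : WindowTree)
    (p : ℕ) : ℕ → ℕ
  | 0 => leafId D p
  | 1 => centerKey D p
  | 2 => (t.records (windowMin A D) (windowMax A D ℓ))[p]?.elim 0 fun r => r.1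
  | _ => (t.records (windowMin A D) (windowMax A D ℓ))[p]?.elim 0 fun r => r.2.1

/-- The real fields: the attribute of the leaf of a dart, an unused field, the minimum of
`windowMax` below a node, and the value of `windowMin` for a leaf of the tree. -/
noncomputable def starReals (A : Fin n → ℝ) (D : List (Fin n × Fin n)) (ℓ : ℕ) (t : WindowTree)
    (p : ℕ) : ℕ → ℝ
  | 0 => leafAttr A D p
  | 1 => 0
  | 2 => (t.records (windowMin A D) (windowMax A D ℓ))[p]?.elim 0 fun r => r.2.2.1
  | _ => (t.records (windowMin A D) (windowMax A D ℓ))[p]?.elim 0 fun r => r.2.2.2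

/-- The data structure for a tree of windows. -/
noncomputable def starStore (A : Fin n → ℝ) (D : List (Fin n × Fin n)) (ℓ : ℕ) (t : WindowTree) :
    Store :=
  .ofFields (max D.length t.size) (starWords A D ℓ t) (starReals A D ℓ t)

variable {t : WindowTree}

theorem word_starStore (p : ℕ) {x : ℕ} (hx : x < 4) :
    (starStore A D ℓ t).word p x = starWords A D ℓ t p x := by
  refine Store.word_ofFields (fun p x hp => ?_) p hx
  rw [max_le_iff] at hp
  have h1 : D[p]? = none := List.getElem?_eq_none hp.1
  have h2 : (t.records (windowMin A D) (windowMax A D ℓ))[p]? = none :=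
    List.getElem?_eq_none (by rw [WindowTree.length_records]; exact hp.2)
  unfold starWords
  split <;> simp [leafId, centerKey, h1, h2]

theorem realAt_starStore (p : ℕ) {x : ℕ} (hx : x < 4) :
    (starStore A D ℓ t).realAt p x = starReals A D ℓ t p x := by
  refine Store.realAt_ofFields (fun p x hp => ?_) p hx
  rw [max_le_iff] at hp
  have h1 : D[p]? = none := List.getElem?_eq_none hp.1
  have h2 : (t.records (windowMin A D) (windowMax A D ℓ))[p]? = none :=
    List.getElem?_eq_none (by rw [WindowTree.length_records]; exact hp.2)
  unfold starReals
  split <;> simp [leafAttr, h1, h2]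

theorem fits_starStore {w : ℕ} (ht : t.leaves = windows A D ℓ) (hn : n < 2 ^ w)
    (hN : max D.length t.size < 2 ^ w) : (starStore A D ℓ t).Fits w := by
  rw [max_lt_iff] at hN
  refine Store.fits_ofFields fun p x => ?_
  unfold starWords
  split
  · rcases h : D[p]? with _ | d
    · simp [leafId, h]
    · simpa [leafId, h] using d.2.isLt.trans hn
  · rcases h : D[p]? with _ | d
    · simp [centerKey, h]
    · have := d.1.isLt
      simp only [centerKey, h, Option.elim_some]
      omega
  all_goals
    rcases h : (t.records (windowMin A D) (windowMax A D ℓ))[p]? with _ | r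
    · simp
    · obtain ⟨h1, h2⟩ := WindowTree.records_bounds (List.mem_of_getElem? h)
      simp only [Option.elim_some]
      first
      | exact h1.trans_lt hN.2
      | rcases h2 with h2 | h2
        · rw [h2]
          positivity
        · rw [ht] at h2
          exact (mem_windows.1 h2).1.trans hN.1

theorem placed_starStore :
    t.Placed (starStore A D ℓ t) (windowMin A D) (windowMax A D ℓ) 0 := by
  refine WindowTree.placed_of_records t 0 fun i r hr => ?_
  simp [word_starStore, realAt_starStore, starWords, starReals, hr]

/-- The answer to a listing query, together with the runs that produce it. -/
theorem IsDartList.exists_query (hD : IsDartList G A D) (hℓ : 2 ≤ ℓ) (ht : t.leaves = windows A D ℓ)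
    {w : ℕ} (hS : (starStore A D ℓ t).Fits w)
    (hN : 4 * (max D.length t.size + ℓ) + 8 ≤ 2 ^ w) (x₁ x₂ : ℝ) :
    ∃ outs, DescribesAllOnce (starPattern ℓ) outs (occurrences (starPattern ℓ) G A x₁ x₂) ∧
      ∀ Δ, 20 * (3 * t.depth + 2 * ℓ + 5) ≤ Δ →
        Resumes (listingProgram ℓ) (starStore A D ℓ t) w Δ Δ (State.init x₁ x₂) outs := by
  classical
  have hb := fun j (hj : j ∈ windows A D ℓ) (hx : windowMax A D ℓ j ≤ x₂) => hD.exists_bound hj hx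
  choose! R hRD hRℓ hR using hb
  refine ⟨_, hD.describesAllOnce hℓ nodup_starPositions
    (fun js => hD.mem_starPositions hℓ hR), fun Δ hΔ => ?_⟩
  have key := resumes_query_tree (x₁ := x₁) (x₂ := x₂) (Δ := Δ)
    (out := fun j => (combinations (ℓ - 1) (List.range' (j + 1) (R j - (j + 1)))).map
      fun js => [centerKey D j - 1, leafId D j] ++ js.map (leafId D))
    hℓ hS hN placed_starStore (le_max_right _ _) ?_ ?_ hΔ
  · convert key using 1
    rw [ht, windowOutputs_eq_flatMap pairwise_windows, starPositions, List.map_flatMap]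
    simp [starTuple, Function.comp_def]
  · rw [word_starStore _ (by omega)]
    simp [starWords, WindowTree.length_records]
  · intro j hj hmax _
    rw [ht] at hj
    refine ⟨R j, (hRD j hj hmax).trans (le_max_left _ _), hRℓ j hj hmax, fun p hp => ?_, ?_⟩
    · rw [word_starStore _ (by omega), word_starStore _ (by omega), realAt_starStore _ (by omega)]
      exact hR j hj hmax p hp
    · simp only [word_starStore _ (show 1 < 4 by omega), word_starStore _ (show 0 < 4 by omega)]
      rfl

theorem IsDartList.exists_query_of_windows_eq_nil (hD : IsDartList G A D) (hℓ : 2 ≤ ℓ)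
    (h : windows A D ℓ = []) {w : ℕ} (hw : 4 * (0 + ℓ) + 8 ≤ 2 ^ w) (x₁ x₂ : ℝ) :
    ∃ outs, DescribesAllOnce (starPattern ℓ) outs (occurrences (starPattern ℓ) G A x₁ x₂) ∧
      ∀ Δ, 9 ≤ Δ → Resumes (listingProgram ℓ) ⟨[], []⟩ w Δ Δ (State.init x₁ x₂) outs := by
  refine ⟨_, hD.describesAllOnce (l := starPositions A D ℓ x₁ x₂ fun _ => 0) hℓ nodup_starPositions
    (fun js => hD.mem_starPositions hℓ (by simp [h])), fun Δ hΔ => ?_⟩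
  simpa [starPositions, h] using resumes_query_empty (x₁ := x₁) (x₂ := x₂) hw hΔ

theorem IsDartList.length_le (hD : IsDartList G A D) : D.length ≤ n ^ 2 := by
  simpa [sq] using hD.nodup.length_le_card

/-- A data structure for the graph, together with the runs on it. -/
theorem exists_store (hℓ : 2 ≤ ℓ) (G : SimpleGraph (Fin n)) (A : Fin n → ℝ) {w : ℕ}
    (hw : 8 * n ^ 2 + 4 * ℓ + 8 ≤ 2 ^ w) :
    ∃ S : Store, S.Fits w ∧ S.space ≤ 32 * G.edgeSet.ncard ∧ ∀ x₁ x₂ : ℝ,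
      ∃ outs, DescribesAllOnce (starPattern ℓ) outs (occurrences (starPattern ℓ) G A x₁ x₂) ∧
        ∀ Δ, 60 * Nat.log 2 (G.edgeSet.ncard + 2) + 40 * ℓ + 220 ≤ Δ →
          Resumes (listingProgram ℓ) S w Δ Δ (State.init x₁ x₂) outs := by
  obtain ⟨D, hD⟩ := exists_isDartList G A
  have hDn := hD.length_le
  have hDm := hD.length_eq
  by_cases h : windows A D ℓ = []
  · refine ⟨⟨[], []⟩, by simp [Store.Fits], by simp [Store.space], fun x₁ x₂ => ?_⟩
    obtain ⟨outs, h1, h2⟩ := hD.exists_query_of_windows_eq_nil hℓ h (w := w) (by omega) x₁ x₂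
    exact ⟨outs, h1, fun Δ hΔ => h2 Δ (by omega)⟩
  · have hlen := length_windows_le (A := A) (D := D) (ℓ := ℓ)
    have hlog := Nat.lt_pow_succ_log_self one_lt_two (G.edgeSet.ncard + 2)
    -- With `m` edges there are at most `2m` windows, and `m + 2 < 2 ^ (log (m + 2) + 1)`.
    obtain ⟨t, ht, hd⟩ := WindowTree.exists_leaves_eq (Nat.log 2 (G.edgeSet.ncard + 2) + 2) h
      (by rw [pow_succ]; omega)
    have hsize := t.size_add_one
    rw [ht] at hsize
    -- A tree with at most `2m` leaves has fewer than `4m` nodes; eight cells per record give the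
    -- bound `32m`.
    have hN : max D.length t.size ≤ 4 * G.edgeSet.ncard := by omega
    have hn : n ≤ n ^ 2 := Nat.le_self_pow two_ne_zero n
    have hS : (starStore A D ℓ t).Fits w := fits_starStore ht (by omega) (by omega)
    refine ⟨_, hS, ?_, fun x₁ x₂ => ?_⟩
    · rw [starStore, Store.space_ofFields]
      omega
    · obtain ⟨outs, h1, h2⟩ := hD.exists_query hℓ ht hS (by omega) x₁ x₂
      exact ⟨outs, h1, fun Δ hΔ => h2 Δ (by omega)⟩

end StarStore

/-- There are at most `n ^ 2` darts, hence at most `2 * n ^ 2` records of four words each; the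
remaining terms leave room for the look-ahead of the loops, so that addresses never wrap around. -/
theorem le_two_pow_wordLength (ℓ n : ℕ) :
    8 * n ^ 2 + 4 * ℓ + 8 ≤ 2 ^ wordLength (ℓ + 5) n := by
  have h1 : n + 2 ≤ 2 ^ Nat.clog 2 (n + 2) := Nat.le_pow_clog one_lt_two _
  have h2 : ℓ < 2 ^ ℓ := Nat.lt_two_pow_self
  calc 8 * n ^ 2 + 4 * ℓ + 8 ≤ (n + 2) ^ 2 * (8 * (ℓ + 1)) := by nlinarith [Nat.zero_le (n * ℓ)]
    _ ≤ (n + 2) ^ 2 * (8 * 2 ^ ℓ) := by gcongr; omega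
    _ = (n + 2) ^ 2 * 2 ^ (ℓ + 3) := by ring
    _ ≤ (n + 2) ^ 2 * (n + 2) ^ (ℓ + 3) := by gcongr; omega
    _ = (n + 2) ^ (ℓ + 5) := by ring
    _ ≤ (2 ^ Nat.clog 2 (n + 2)) ^ (ℓ + 5) := by gcongr
    _ = 2 ^ wordLength (ℓ + 5) n := by rw [wordLength, ← pow_mul, mul_comm]

theorem DescribesAllOnce.eq_nil_iff {k n : ℕ} {Q : SimpleGraph (Fin k)} {G : SimpleGraph (Fin n)}
    {outs : List (List ℕ)} {X : Set G.Subgraph} (h : DescribesAllOnce Q outs X) :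
    outs = [] ↔ ¬ X.Nonempty := by
  obtain ⟨Hs, -, hmem, hall⟩ := h
  have hlen := hall.length_eq
  rw [← List.length_eq_zero_iff, hlen, List.length_eq_zero_iff, List.eq_nil_iff_forall_not_mem,
    Set.not_nonempty_iff_eq_empty, Set.eq_empty_iff_forall_notMem]
  simp only [hmem]

end RangeListing

theorem theorem7 (ℓ : ℕ) (hℓ : 2 ≤ ℓ) :
    ∃ (listing detection : RangeListing.Program) (κ C k : ℕ),
      ∀ (n : ℕ) (G : SimpleGraph (Fin n)) (A : Fin n → ℝ),
        ∃ S : RangeListing.Store,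
          S.Fits (RangeListing.wordLength κ n) ∧
          S.space ≤ C * G.edgeSet.ncard ∧
          ∀ x₁ x₂ : ℝ,
            (∃ outs : List (List ℕ),
              RangeListing.ListsWithDelay listing S (RangeListing.wordLength κ n)
                (RangeListing.polylog C k G.edgeSet.ncard)
                (RangeListing.State.init x₁ x₂) outs ∧
              RangeListing.DescribesAllOnce (RangeListing.starPattern ℓ) outs
                (RangeListing.occurrences (RangeListing.starPattern ℓ) G A x₁ x₂)) ∧
            (∃ answer : ℕ,
              RangeListing.AnswersWithin detection S (RangeListing.wordLength κ n)
                (RangeListing.polylog C k G.edgeSet.ncard)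
                (RangeListing.State.init x₁ x₂) answer ∧
              (answer = 1 ↔ (RangeListing.occurrences (RangeListing.starPattern ℓ) G A x₁ x₂).Nonempty) ∧
              (answer = 0 ↔ ¬ (RangeListing.occurrences (RangeListing.starPattern ℓ) G A x₁ x₂).Nonempty)) := by
  -- Address `1` holds the code that answers `1`. As the logarithm is at least one, `40 * ℓ + 300`
  -- absorbs the additive constants of the delay, including the two extra units of detection.
  refine ⟨RangeListing.listingProgram ℓ, (RangeListing.listingProgram ℓ).reportToJump 1, ℓ + 5,
    40 * ℓ + 300, 1, fun n G A => ?_⟩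
  have hw := RangeListing.le_two_pow_wordLength ℓ n
  have hw0 : 0 < RangeListing.wordLength (ℓ + 5) n := by
    by_contra h0
    rw [Nat.eq_zero_of_not_pos h0] at hw
    omega
  obtain ⟨S, hS, hspace, hquery⟩ := RangeListing.exists_store hℓ G A hw
  have hlog : 1 ≤ Nat.log 2 (G.edgeSet.ncard + 2) := Nat.log_pos one_lt_two (by omega)
  have hΔ : 60 * Nat.log 2 (G.edgeSet.ncard + 2) + 40 * ℓ + 220 + 2 ≤
      RangeListing.polylog (40 * ℓ + 300) 1 G.edgeSet.ncard := by
    rw [RangeListing.polylog, pow_one]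
    nlinarith
  refine ⟨S, hS, hspace.trans (Nat.mul_le_mul_right _ (by omega)), fun x₁ x₂ => ?_⟩
  obtain ⟨outs, hdesc, hrun⟩ := hquery x₁ x₂
  refine ⟨⟨outs, (hrun _ (by omega)).lists le_rfl, hdesc⟩, _,
    (hrun _ le_rfl).answersWithin rfl rfl hw0 hΔ, ?_⟩
  have hnil := hdesc.eq_nil_iff
  by_cases h : outs = [] <;> simp_all
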